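/- Let $F$ be a probability distribution on $\mathbb{R}^p$ ($p\ge 1$) with $\int\|x\|^4\,dF(x)<\infty$, where $\|\cdot\|$ is the Euclidean norm; let $X,Y,Z$ be i.i.d. with distribution $F$, and let $X_1,X_2,\dots$ be i.i.d. with distribution $F$, $\boldsymbol X=(X_1,\dots,X_n)$. Write $f_X$ for the characteristic function of $X$, $c_p=\pi^{(p+1)/2}/\Gamma((p+1)/2)$, $$\mathcal V^2(X)=\frac1{c_p^2}\int_{\mathbb{R}^{2p}}\frac{|f_X(s+t)-f_X(s)f_X(t)|^2}{\|s\|^{p+1}\|t\|^{p+1}}\,ds\,dt,\qquad \mathcal V(X)=\sqrt{\mathcal V^2(X)},$$ $\Delta=\mathbb E\|X-Y\|$, $T_1=\mathbb E\|X-Y\|^2$, $T_3=\mathbb E(\|X-Y\|\,\|X-Z\|)$. For the sample, put $$\mathcal V_n^2(\boldsymbol X)=\frac1{n^2}\sum_{i,j}\|X_i-X_j\|^2+\Big(\frac1{n^2}\sum_{i,j}\|X_i-X_j\|\Big)^2-\frac2{n^3}\sum_{i,j,k}\|X_i-X_j\|\,\|X_i-X_k\|,$$ and $\widehat{\mathcal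 V}_n^2=\widehat W_n+\widehat\Delta_n^2$, where $$\widehat\Delta_n=\frac{2}{n(n-1)}\sum_{i<j}\|X_i-X_j\|,\qquad \widehat W_n=\frac1{n(n-1)(n-2)}\sum_{i,j,k\ \text{distinct}}\|X_i-X_j\|\big(\|X_i-X_j\|-2\|X_i-X_k\|\big)$$ are the unbiased estimators of $\Delta$ and of $\mathbb E[\|X-Y\|(\|X-Y\|-2\|X-Z\|)]$. Let $\mathcal V_n$ and $\widehat{\mathcal V}_n$ be the square roots of $\mathcal V_n^2$ and $\widehat{\mathcal V}_n^2$ (with $\widehat{\mathcal V}_n:=0$ where $\widehat{\mathcal V}_n^2<0$). Define $$\psi_1(x)=\mathbb E\|x-Y\|^2,\quad \psi_2(x)=\mathbb E(\|x-Y\|\,\|x-Z\|),\quad \psi_3(x)=\mathbb E(\|x-Y\|\,\|Y-Z\|),\quad \psi_4(x)=\mathbb E\|x-Y\|,$$ $$m_{11}=4\,\mathbb E\big[\psi_1(X)-\psi_2(X)-2\psi_3(X)\big]^2-4(T_1-3T_3)^2,$$ $$m_{12}=4\,\mathbb E\big[\psi_4(X)\big(\psi_1(X)-\psi_2(X)-2\psi_3(X)\big)\big]-4\Delta\,(T_1-3T_3),\qquad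 m_{22}=4\,\mathbb E\,\psi_4^2(X)-4\Delta^2,$$ $$\gamma=m_{11}+4m_{12}\Delta+4m_{22}\Delta^2 .$$ Then $\gamma\ge0$ and, as $n\to\infty$, $$\sqrt n\big(\mathcal V_n^2(\boldsymbol X)-\mathcal V^2(X)\big)\xrightarrow{d}N(0,\gamma),\qquad \sqrt n\big(\widehat{\mathcal V}_n^2(\boldsymbol X)-\mathcal V^2(X)\big)\xrightarrow{d}N(0,\gamma).$$ If moreover $\mathcal V(X)\ne0$, then $$\sqrt n\big(\mathcal V_n(\boldsymbol X)-\mathcal V(X)\big)\xrightarrow{d}N\Big(0,\frac{\gamma}{4\mathcal V^2(X)}\Big),\qquad \sqrt n\big(\widehat{\mathcal V}_n(\boldsymbol X)-\mathcal V(X)\big)\xrightarrow{d}N\Big(0,\frac{\gamma}{4\mathcal V^2(X)}\Big).$$ Here $N(0,0)$ denotes the point mass at $0$. -/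

import Mathlib

open MeasureTheory ProbabilityTheory Filter

noncomputable section

/-! Population quantities. They depend only on the law `F` of the random vector `X`;
in the comments `X, Y, Z` (or `X, X', X''`) are i.i.d. with law `F`. -/

/-- The constant `c_p = π^((p+1)/2) / Γ((p+1)/2)`. -/
def cConst (p : ℕ) : ℝ := Real.pi ^ (((p : ℝ) + 1) / 2) / Real.Gamma (((p : ℝ) + 1) / 2)

/-- The distance variance `𝒱²(X)`, defined through the characteristic function of `X`. -/
def distVar {p : ℕ} (F : Measure (EuclideanSpace ℝ (Fin p))) : ℝ :=
  1 / cConst p ^ 2 *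
    ∫ w : EuclideanSpace ℝ (Fin p) × EuclideanSpace ℝ (Fin p),
      ‖charFun F (w.1 + w.2) - charFun F w.1 * charFun F w.2‖ ^ 2 /
        (‖w.1‖ ^ (p + 1) * ‖w.2‖ ^ (p + 1))

/-- The distance standard deviation `𝒱(X)`. -/
def distSD {p : ℕ} (F : Measure (EuclideanSpace ℝ (Fin p))) : ℝ := Real.sqrt (distVar F)

/-- Gini's mean difference `Δ(X) = E‖X - X'‖`. -/
def gini {p : ℕ} (F : Measure (EuclideanSpace ℝ (Fin p))) : ℝ :=
  ∫ w, ‖w.1 - w.2‖ ∂(F.prod F)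

/-- `T₁(X) = E‖X - X'‖²`. -/
def popT1 {p : ℕ} (F : Measure (EuclideanSpace ℝ (Fin p))) : ℝ :=
  ∫ w, ‖w.1 - w.2‖ ^ 2 ∂(F.prod F)

/-- `T₃(X) = E(‖X - X'‖ ‖X - X''‖)`. -/
def popT3 {p : ℕ} (F : Measure (EuclideanSpace ℝ (Fin p))) : ℝ :=
  ∫ w, ‖w.1 - w.2.1‖ * ‖w.1 - w.2.2‖ ∂(F.prod (F.prod F))

/-- `ψ₁(x) = E‖x - Y‖²`. -/
def psi1 {p : ℕ} (F : Measure (EuclideanSpace ℝ (Fin p))) (x : EuclideanSpace ℝ (Fin p)) : ℝ :=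
  ∫ y, ‖x - y‖ ^ 2 ∂F

/-- `ψ₂(x) = E(‖x - Y‖ ‖x - Z‖)`. -/
def psi2 {p : ℕ} (F : Measure (EuclideanSpace ℝ (Fin p))) (x : EuclideanSpace ℝ (Fin p)) : ℝ :=
  ∫ w, ‖x - w.1‖ * ‖x - w.2‖ ∂(F.prod F)

/-- `ψ₃(x) = E(‖x - Y‖ ‖Y - Z‖)`. -/
def psi3 {p : ℕ} (F : Measure (EuclideanSpace ℝ (Fin p))) (x : EuclideanSpace ℝ (Fin p)) : ℝ :=
  ∫ w, ‖x - w.1‖ * ‖w.1 - w.2‖ ∂(F.prod F)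

/-- `ψ₄(x) = E‖x - Y‖`. -/
def psi4 {p : ℕ} (F : Measure (EuclideanSpace ℝ (Fin p))) (x : EuclideanSpace ℝ (Fin p)) : ℝ :=
  ∫ y, ‖x - y‖ ∂F

/-- `m₁₁ = 4 E[ψ₁(X) - ψ₂(X) - 2ψ₃(X)]² - 4 (T₁(X) - 3T₃(X))²`. -/
def m11 {p : ℕ} (F : Measure (EuclideanSpace ℝ (Fin p))) : ℝ :=
  4 * ∫ x, (psi1 F x - psi2 F x - 2 * psi3 F x) ^ 2 ∂F - 4 * (popT1 F - 3 * popT3 F) ^ 2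

/-- `m₁₂ = 4 E[ψ₄(X) (ψ₁(X) - ψ₂(X) - 2ψ₃(X))] - 4 Δ(X) (T₁(X) - 3T₃(X))`. -/
def m12 {p : ℕ} (F : Measure (EuclideanSpace ℝ (Fin p))) : ℝ :=
  4 * ∫ x, psi4 F x * (psi1 F x - psi2 F x - 2 * psi3 F x) ∂F
    - 4 * gini F * (popT1 F - 3 * popT3 F)

/-- `m₂₂ = 4 E ψ₄(X)² - 4 Δ(X)²`. -/
def m22 {p : ℕ} (F : Measure (EuclideanSpace ℝ (Fin p))) : ℝ :=
  4 * ∫ x, psi4 F x ^ 2 ∂F - 4 * gini F ^ 2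

/-- `γ = m₁₁ + 4 m₁₂ Δ(X) + 4 m₂₂ Δ²(X)`. -/
def gammaVar {p : ℕ} (F : Measure (EuclideanSpace ℝ (Fin p))) : ℝ :=
  m11 F + 4 * m12 F * gini F + 4 * m22 F * gini F ^ 2

/-! Sample quantities, as functions of a sample `x₁, …, xₙ`. -/

/-- `T_{1,n}`. -/
def sampleT1 {p n : ℕ} (x : Fin n → EuclideanSpace ℝ (Fin p)) : ℝ :=
  1 / (n : ℝ) ^ 2 * ∑ i, ∑ j, ‖x i - x j‖ ^ 2

/-- `T_{2,n}`. -/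
def sampleT2 {p n : ℕ} (x : Fin n → EuclideanSpace ℝ (Fin p)) : ℝ :=
  (1 / (n : ℝ) ^ 2 * ∑ i, ∑ j, ‖x i - x j‖) ^ 2

/-- `T_{3,n}`. -/
def sampleT3 {p n : ℕ} (x : Fin n → EuclideanSpace ℝ (Fin p)) : ℝ :=
  1 / (n : ℝ) ^ 3 * ∑ i, ∑ j, ∑ k, ‖x i - x j‖ * ‖x i - x k‖

/-- The sample distance variance `𝒱ₙ²`. -/
def sampleDistVar {p n : ℕ} (x : Fin n → EuclideanSpace ℝ (Fin p)) : ℝ :=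
  sampleT1 x + sampleT2 x - 2 * sampleT3 x

/-- The sample distance standard deviation `𝒱ₙ`. -/
def sampleDistSD {p n : ℕ} (x : Fin n → EuclideanSpace ℝ (Fin p)) : ℝ :=
  Real.sqrt (sampleDistVar x)

/-- The unbiased sample Gini mean difference `Δ̂ₙ`. -/
def hatGini {p n : ℕ} (x : Fin n → EuclideanSpace ℝ (Fin p)) : ℝ :=
  2 / ((n : ℝ) * ((n : ℝ) - 1)) * ∑ i, ∑ j ∈ Finset.Ioi i, ‖x i - x j‖

/-- The unbiased estimator `Ŵₙ` of `W(X) = E[‖X - Y‖ (‖X - Y‖ - 2‖X - Z‖)]`. -/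
def hatW {p n : ℕ} (x : Fin n → EuclideanSpace ℝ (Fin p)) : ℝ :=
  1 / ((n : ℝ) * ((n : ℝ) - 1) * ((n : ℝ) - 2)) *
    ∑ i, ∑ j, ∑ k, if i ≠ j ∧ j ≠ k ∧ k ≠ i then
      ‖x i - x j‖ * (‖x i - x j‖ - 2 * ‖x i - x k‖) else 0

/-- `𝒱̂ₙ² = Ŵₙ + Δ̂ₙ²`. -/
def hatDistVar {p n : ℕ} (x : Fin n → EuclideanSpace ℝ (Fin p)) : ℝ :=
  hatW x + hatGini x ^ 2

/-- `𝒱̂ₙ`, the square root of `𝒱̂ₙ²` (taken as `0` where `𝒱̂ₙ²` is negative). -/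
def hatDistSD {p n : ℕ} (x : Fin n → EuclideanSpace ℝ (Fin p)) : ℝ :=
  Real.sqrt (hatDistVar x)

end

/-! ### The integral defining the weight of the distance variance -/

/-! The proof moves everything to the doubly centred distance a(x,y) = ‖x-y‖ - ψ₄(x) - ψ₄(y) + Δ,
written `ctrDist`, which satisfies E a(x,Y) = 0.

Population side: the weight is chosen so that ∫ (1 - cos⟨x,t⟩) ‖t‖^{-(p+1)} dt = c_p ‖x‖
(`lintegral_one_sub_cos_div_norm_pow`). By polarisation, the centred characters of x and y have
weighted inner product -c_p a(x,y) (`integrable_ctrChar_mul_conj`). Fubini over two frequencies and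
two sample points then gives 𝒱² = E a(X,Y)² (`distVar_eq_integral_ctrDist_sq`).

Sample side: 𝒱ₙ² does not change when a term uᵢ + uⱼ is added to the distance matrix, so distances
may be replaced by a(Xᵢ,Xⱼ) (`sampleDistVar_eq`). With g(x) = E a(x,Y)², the Hoeffding decomposition
of a² gives 𝒱ₙ² - 𝒱² = (2/n) Σ (g(Xᵢ) - 𝒱²) + remainder. The remainder is built only from degenerate
sums, whose second moments are of the order of the number of pairs (`integral_sq_sum_sum_le`), so it
is O(1/n) in L¹.

The classical central limit theorem thus applies with variance 4 Var g(X), which expands to γ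
(`gammaVar_eq`); this also shows γ ≥ 0. The unbiased version differs from 𝒱ₙ² by O(1/n) in L¹
(`abs_hatDistVar_sub_le`), so it has the same limit. The square roots follow by the delta method
(`tendstoInDistribution_sqrt`). -/

lemma lintegral_rpow_mul_exp_neg_mul_Ioi {a r : ℝ} (ha : 0 < a) (hr : 0 < r) :
    ∫⁻ t in Set.Ioi (0 : ℝ), ENNReal.ofReal (t ^ (a - 1) * Real.exp (-(r * t))) =
      ENNReal.ofReal ((1 / r) ^ a * Real.Gamma a) := by
  have hint := Real.integral_rpow_mul_exp_neg_mul_Ioi ha hr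
  have hpos : 0 < (1 / r) ^ a * Real.Gamma a := by
    have := Real.Gamma_pos_of_pos ha
    positivity
  rw [← hint, ofReal_integral_eq_lintegral_ofReal]
  · exact Integrable.of_integral_ne_zero (by rw [hint]; exact hpos.ne')
  · filter_upwards [ae_restrict_mem measurableSet_Ioi] with t ht
    have : 0 < t := ht
    show 0 ≤ t ^ (a - 1) * Real.exp (-(r * t))
    positivity

/-- The substitution u ↦ 1/u turns this into the Gamma integral at 1/2. -/
lemma lintegral_rpow_mul_exp_neg_div_Ioi {b : ℝ} (hb : 0 < b) :
    ∫⁻ u in Set.Ioi (0 : ℝ), ENNReal.ofReal (u ^ (-(3 / 2) : ℝ) * Real.exp (-(b / u))) =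
      ENNReal.ofReal (√Real.pi * b ^ (-(1 / 2) : ℝ)) := by
  have h1 := Real.integral_rpow_mul_exp_neg_mul_Ioi (a := 1 / 2) (r := b) (by norm_num) hb
  have h2 := integral_comp_rpow_Ioi
    (fun y : ℝ => y ^ ((1 / 2 : ℝ) - 1) * Real.exp (-(b * y))) (p := -1) (by norm_num)
  rw [h1, Real.Gamma_one_half_eq] at h2
  have h3 : ∫ u in Set.Ioi (0 : ℝ), u ^ (-(3 / 2) : ℝ) * Real.exp (-(b / u)) =
      √Real.pi * b ^ (-(1 / 2) : ℝ) := by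
    rw [Real.rpow_neg hb.le, ← Real.inv_rpow hb.le, mul_comm (√Real.pi), ← one_div b, ← h2]
    refine setIntegral_congr_fun measurableSet_Ioi fun u hu => ?_
    have hu : 0 < u := hu
    simp only [smul_eq_mul, abs_neg, abs_one, one_mul]
    rw [← Real.rpow_mul hu.le, ← mul_assoc, ← Real.rpow_add hu, Real.rpow_neg_one, div_eq_mul_inv b u]
    norm_num
  rw [← h3, ofReal_integral_eq_lintegral_ofReal]
  · refine Integrable.of_integral_ne_zero ?_
    rw [h3]
    have := Real.pi_pos
    positivity
  · filter_upwards [ae_restrict_mem measurableSet_Ioi] with t ht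
    have : 0 < t := ht
    show 0 ≤ t ^ (-(3 / 2) : ℝ) * Real.exp (-(b / t))
    positivity

/-- Since 1 - exp(-a/u) = ∫₀ᵃ u⁻¹ exp(-b/u) db, Tonelli reduces the integral to that of √π b^{-1/2}
over (0,a]. -/
lemma lintegral_rpow_mul_one_sub_exp_neg_div_Ioi {a : ℝ} (ha : 0 ≤ a) :
    ∫⁻ u in Set.Ioi (0 : ℝ), ENNReal.ofReal (u ^ (-(1 / 2) : ℝ) * (1 - Real.exp (-(a / u)))) =
      ENNReal.ofReal (2 * √Real.pi * √a) := by
  have h1 : ∀ u ∈ Set.Ioi (0 : ℝ),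
      ENNReal.ofReal (u ^ (-(1 / 2) : ℝ) * (1 - Real.exp (-(a / u)))) =
      ∫⁻ b in Set.Ioc 0 a, ENNReal.ofReal (u ^ (-(3 / 2) : ℝ) * Real.exp (-(b / u))) := by
    intro u hu
    have hu : 0 < u := hu
    rw [← ofReal_integral_eq_lintegral_ofReal]
    · rw [← intervalIntegral.integral_of_le ha]
      congr 1
      have hd : ∀ b ∈ Set.uIcc 0 a,
          HasDerivAt (fun b => -(u ^ (-(1 / 2) : ℝ) * Real.exp (-(b / u))))
            (u ^ (-(3 / 2) : ℝ) * Real.exp (-(b / u))) b := by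
        intro b _
        have := (((hasDerivAt_id b).div_const u).neg.exp.const_mul (u ^ (-(1 / 2) : ℝ))).neg
        refine this.congr_deriv ?_
        have : u ^ (-(3 / 2) : ℝ) = u ^ (-(1 / 2) : ℝ) * u⁻¹ := by
          rw [← Real.rpow_neg_one, ← Real.rpow_add hu]; norm_num
        rw [this]
        simp
        ring
      rw [intervalIntegral.integral_eq_sub_of_hasDerivAt hd]
      · simp; ring
      · exact Continuous.intervalIntegrable (by fun_prop) _ _
    · exact (Continuous.integrableOn_Icc (by fun_prop)).mono_set Set.Ioc_subset_Icc_self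
    · exact Eventually.of_forall fun b => by positivity
  rw [setLIntegral_congr_fun measurableSet_Ioi h1, lintegral_lintegral_swap]
  · have h2 : ∀ b ∈ Set.Ioc (0 : ℝ) a,
        ∫⁻ u in Set.Ioi (0 : ℝ), ENNReal.ofReal (u ^ (-(3 / 2) : ℝ) * Real.exp (-(b / u))) =
        ENNReal.ofReal (√Real.pi * b ^ (-(1 / 2) : ℝ)) :=
      fun b hb => lintegral_rpow_mul_exp_neg_div_Ioi hb.1
    rw [setLIntegral_congr_fun measurableSet_Ioc h2, ← ofReal_integral_eq_lintegral_ofReal]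
    · rw [integral_const_mul, ← intervalIntegral.integral_of_le ha,
        integral_rpow (Or.inl (by norm_num)), Real.sqrt_eq_rpow a]
      congr 1
      norm_num
      ring
    · refine Integrable.const_mul ?_ _
      exact (intervalIntegrable_iff_integrableOn_Ioc_of_le ha).1
        (intervalIntegral.intervalIntegrable_rpow' (by norm_num))
    · filter_upwards [ae_restrict_mem measurableSet_Ioc] with t ht
      have : 0 < t := ht.1
      show 0 ≤ √Real.pi * t ^ (-(1 / 2) : ℝ)
      positivity
  · refine Measurable.aemeasurable ?_
    unfold Function.uncurry
    fun_prop

/-- The cosine part is the real part of the Fourier transform of a Gaussian. -/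
lemma lintegral_one_sub_cos_mul_gaussian {p : ℕ} (x : EuclideanSpace ℝ (Fin p)) {u : ℝ}
    (hu : 0 < u) :
    ∫⁻ t : EuclideanSpace ℝ (Fin p),
      ENNReal.ofReal ((1 - Real.cos (inner ℝ x t)) * Real.exp (-u * ‖t‖ ^ 2)) =
      ENNReal.ofReal ((Real.pi / u) ^ ((p : ℝ) / 2) * (1 - Real.exp (-(‖x‖ ^ 2 / 4 / u)))) := by
  have hcu : 0 < (u : ℂ).re := by simpa using hu
  have hI := GaussianFourier.integrable_cexp_neg_mul_sq_norm_add hcu Complex.I x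
  have hE := GaussianFourier.integral_cexp_neg_mul_sq_norm_add hcu Complex.I x
  have hre : ∀ t : EuclideanSpace ℝ (Fin p),
      (Complex.exp (-(u : ℂ) * (‖t‖ : ℂ) ^ 2 + Complex.I * (inner ℝ x t : ℝ))).re =
        Real.cos (inner ℝ x t) * Real.exp (-u * ‖t‖ ^ 2) := by
    intro t
    rw [Complex.exp_re]
    simp [← Complex.ofReal_pow, mul_comm]
  have hG : Integrable fun t : EuclideanSpace ℝ (Fin p) => Real.exp (-u * ‖t‖ ^ 2) := by
    have := (GaussianFourier.integrable_cexp_neg_mul_sq_norm_add hcu 0 x).re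
    refine this.congr (Eventually.of_forall fun t => ?_)
    simp only [RCLike.re_to_complex, Complex.exp_re]
    simp [← Complex.ofReal_pow]
  have hC : Integrable fun t : EuclideanSpace ℝ (Fin p) =>
      Real.cos (inner ℝ x t) * Real.exp (-u * ‖t‖ ^ 2) := by
    refine hI.re.congr (Eventually.of_forall fun t => ?_)
    exact hre t
  have hCi : ∫ t : EuclideanSpace ℝ (Fin p), Real.cos (inner ℝ x t) * Real.exp (-u * ‖t‖ ^ 2) =
      (Real.pi / u) ^ ((p : ℝ) / 2) * Real.exp (-(‖x‖ ^ 2 / 4 / u)) := by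
    have h := congrArg Complex.re hE
    rw [← RCLike.re_to_complex, ← integral_re hI] at h
    simp only [RCLike.re_to_complex, hre] at h
    rw [h, Complex.I_sq, finrank_euclideanSpace_fin]
    have e1 : ((Real.pi : ℂ) / (u : ℂ)) ^ ((p : ℂ) / 2) =
        (((Real.pi / u) ^ ((p : ℝ) / 2) : ℝ) : ℂ) := by
      rw [Complex.ofReal_cpow (by have := Real.pi_pos; positivity)]
      push_cast; rfl
    have e2 : Complex.exp (-1 * (‖x‖ : ℂ) ^ 2 / (4 * (u : ℂ))) =
        ((Real.exp (-(‖x‖ ^ 2 / 4 / u)) : ℝ) : ℂ) := by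
      push_cast
      congr 1
      field_simp
    rw [e1, e2, ← Complex.ofReal_mul, Complex.ofReal_re]
  have hsub : (fun t : EuclideanSpace ℝ (Fin p) =>
      (1 - Real.cos (inner ℝ x t)) * Real.exp (-u * ‖t‖ ^ 2)) =
      fun t => Real.exp (-u * ‖t‖ ^ 2) - Real.cos (inner ℝ x t) * Real.exp (-u * ‖t‖ ^ 2) := by
    ext t; ring
  rw [← ofReal_integral_eq_lintegral_ofReal]
  · rw [hsub, integral_sub hG hC, hCi, GaussianFourier.integral_rexp_neg_mul_sq_norm hu,
      finrank_euclideanSpace_fin]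
    congr 1; ring
  · rw [hsub]; exact hG.sub hC
  · exact Eventually.of_forall fun t =>
      mul_nonneg (sub_nonneg.2 (Real.cos_le_one _)) (Real.exp_pos _).le

lemma cConst_pos (p : ℕ) : 0 < cConst p := by
  have h1 := Real.pi_pos
  have h2 : 0 < Real.Gamma (((p : ℝ) + 1) / 2) := Real.Gamma_pos_of_pos (by positivity)
  unfold cConst
  positivity

/-- The integral representation of the Euclidean norm underlying the distance covariance. -/
lemma lintegral_one_sub_cos_div_norm_pow {p : ℕ} (x : EuclideanSpace ℝ (Fin p)) :
    ∫⁻ t : EuclideanSpace ℝ (Fin p),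
      ENNReal.ofReal ((1 - Real.cos (inner ℝ x t)) / ‖t‖ ^ (p + 1)) =
      ENNReal.ofReal (cConst p * ‖x‖) := by
  set q : ℝ := ((p : ℝ) + 1) / 2 with hq
  have hq0 : 0 < q := by positivity
  have hΓ : 0 < Real.Gamma q := Real.Gamma_pos_of_pos hq0
  have hcos : ∀ t : EuclideanSpace ℝ (Fin p), 0 ≤ 1 - Real.cos (inner ℝ x t) :=
    fun t => sub_nonneg.2 (Real.cos_le_one _)
  -- Subordination: ‖t‖^{-2q} = Γ(q)⁻¹ ∫ u^{q-1} exp(-u‖t‖²) du with 2q = p+1. At t = 0 both sides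
  -- vanish because 1 - cos 0 = 0.
  have h1 : ∀ t : EuclideanSpace ℝ (Fin p),
      ENNReal.ofReal ((1 - Real.cos (inner ℝ x t)) / ‖t‖ ^ (p + 1)) =
      ENNReal.ofReal (1 / Real.Gamma q) * ∫⁻ u in Set.Ioi (0 : ℝ),
        ENNReal.ofReal (u ^ (q - 1)) *
          ENNReal.ofReal ((1 - Real.cos (inner ℝ x t)) * Real.exp (-u * ‖t‖ ^ 2)) := by
    intro t
    rcases eq_or_ne t 0 with rfl | ht
    · simp
    have ht' : 0 < ‖t‖ := norm_pos_iff.2 ht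
    have h2 : ∀ u ∈ Set.Ioi (0 : ℝ), ENNReal.ofReal (u ^ (q - 1)) *
          ENNReal.ofReal ((1 - Real.cos (inner ℝ x t)) * Real.exp (-u * ‖t‖ ^ 2)) =
        ENNReal.ofReal (1 - Real.cos (inner ℝ x t)) *
          ENNReal.ofReal (u ^ (q - 1) * Real.exp (-(‖t‖ ^ 2 * u))) := by
      intro u hu
      have hu : 0 < u := hu
      rw [← ENNReal.ofReal_mul (by positivity), ← ENNReal.ofReal_mul (hcos t)]
      congr 1
      rw [neg_mul, mul_comm u (‖t‖ ^ 2)]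
      ring
    rw [setLIntegral_congr_fun measurableSet_Ioi h2, lintegral_const_mul' _ _ ENNReal.ofReal_ne_top,
      lintegral_rpow_mul_exp_neg_mul_Ioi hq0 (by positivity), ← ENNReal.ofReal_mul (hcos t),
      ← ENNReal.ofReal_mul (by positivity)]
    congr 1
    have h3 : (1 / ‖t‖ ^ 2) ^ q = 1 / ‖t‖ ^ (p + 1) := by
      rw [one_div, Real.inv_rpow (by positivity), ← Real.rpow_natCast, ← Real.rpow_mul ht'.le, hq,
        ← Real.rpow_natCast, one_div]
      congr 2
      push_cast
      ring
    rw [h3]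
    field_simp
  simp_rw [h1]
  rw [lintegral_const_mul' _ _ ENNReal.ofReal_ne_top, lintegral_lintegral_swap]
  · have h4 : ∀ u ∈ Set.Ioi (0 : ℝ), ∫⁻ t : EuclideanSpace ℝ (Fin p),
        ENNReal.ofReal (u ^ (q - 1)) *
          ENNReal.ofReal ((1 - Real.cos (inner ℝ x t)) * Real.exp (-u * ‖t‖ ^ 2)) =
        ENNReal.ofReal (Real.pi ^ ((p : ℝ) / 2)) *
          ENNReal.ofReal (u ^ (-(1 / 2) : ℝ) * (1 - Real.exp (-(‖x‖ ^ 2 / 4 / u)))) := by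
      intro u hu
      have hu : 0 < u := hu
      have hπ := Real.pi_pos
      rw [lintegral_const_mul' _ _ ENNReal.ofReal_ne_top, lintegral_one_sub_cos_mul_gaussian x hu,
        ← ENNReal.ofReal_mul (by positivity), ← ENNReal.ofReal_mul (by positivity)]
      congr 1
      have h5 : u ^ (q - 1) * (Real.pi / u) ^ ((p : ℝ) / 2) =
          Real.pi ^ ((p : ℝ) / 2) * u ^ (-(1 / 2) : ℝ) := by
        rw [Real.div_rpow hπ.le hu.le, mul_div_assoc', mul_comm, mul_div_assoc, ← Real.rpow_sub hu]
        congr 2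
        rw [hq]; ring
      rw [← mul_assoc, h5, mul_assoc]
    have hpi := Real.pi_pos
    rw [setLIntegral_congr_fun measurableSet_Ioi h4, lintegral_const_mul' _ _ ENNReal.ofReal_ne_top,
      lintegral_rpow_mul_one_sub_exp_neg_div_Ioi (by positivity),
      ← ENNReal.ofReal_mul (by positivity), ← ENNReal.ofReal_mul (by positivity)]
    congr 1
    have h6 : √(‖x‖ ^ 2 / 4) = ‖x‖ / 2 := by
      rw [show ‖x‖ ^ 2 / 4 = (‖x‖ / 2) ^ 2 by ring, Real.sqrt_sq (by positivity)]
    have h7 : Real.pi ^ q = Real.pi ^ ((p : ℝ) / 2) * √Real.pi := by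
      rw [Real.sqrt_eq_rpow, ← Real.rpow_add hpi, hq]
      congr 1; ring
    rw [h6, cConst, ← hq, h7]
    ring
  · refine Measurable.aemeasurable ?_
    unfold Function.uncurry
    fun_prop

/-! ### The distance variance as a second moment of the doubly centred distance -/

section DistVar

variable {p : ℕ}

/-- The measure `‖s‖^{-(p+1)} ds`. -/
noncomputable def weightMeasure (p : ℕ) : Measure (EuclideanSpace ℝ (Fin p)) :=
  volume.withDensity fun t => ENNReal.ofReal (1 / ‖t‖ ^ (p + 1))

instance : SigmaFinite (weightMeasure p) := SigmaFinite.withDensity_ofReal _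

/-- The doubly centred distance `‖x - y‖ - E‖x - Y‖ - E‖X - y‖ + E‖X - Y‖`. -/
noncomputable def ctrDist (F : Measure (EuclideanSpace ℝ (Fin p)))
    (x y : EuclideanSpace ℝ (Fin p)) : ℝ :=
  ‖x - y‖ - psi4 F x - psi4 F y + gini F

/-- The centred character `exp(i⟨x, s⟩) - f_X(s)`. -/
noncomputable def ctrChar (F : Measure (EuclideanSpace ℝ (Fin p)))
    (x s : EuclideanSpace ℝ (Fin p)) : ℂ :=
  Complex.exp ((inner ℝ x s : ℝ) * Complex.I) - charFun F s

lemma integrable_one_sub_cos (x : EuclideanSpace ℝ (Fin p)) :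
    Integrable (fun t => 1 - Real.cos (inner ℝ x t)) (weightMeasure p) ∧
      ∫ t, (1 - Real.cos (inner ℝ x t)) ∂(weightMeasure p) = cConst p * ‖x‖ := by
  have hl : ∫⁻ t, ENNReal.ofReal (1 - Real.cos (inner ℝ x t)) ∂(weightMeasure p) =
      ENNReal.ofReal (cConst p * ‖x‖) := by
    rw [weightMeasure, lintegral_withDensity_eq_lintegral_mul _ (by fun_prop) (by fun_prop),
      ← lintegral_one_sub_cos_div_norm_pow]
    refine lintegral_congr fun t => ?_
    rw [Pi.mul_apply, ← ENNReal.ofReal_mul (by positivity)]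
    congr 1; ring
  have h0 : 0 ≤ᵐ[weightMeasure p] fun t => 1 - Real.cos (inner ℝ x t) :=
    Eventually.of_forall fun t => sub_nonneg.2 (Real.cos_le_one _)
  have hm : AEStronglyMeasurable (fun t => 1 - Real.cos (inner ℝ x t)) (weightMeasure p) := by
    fun_prop
  refine ⟨⟨hm, ?_⟩, ?_⟩
  · rw [hasFiniteIntegral_iff_ofReal h0, hl]
    exact ENNReal.ofReal_lt_top
  · rw [integral_eq_lintegral_of_nonneg_ae h0 hm, hl, ENNReal.toReal_ofReal]
    exact mul_nonneg (cConst_pos p).le (norm_nonneg _)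

lemma integrable_integral_one_sub_cos {S : Type*} [MeasurableSpace S] (G : Measure S) [SFinite G]
    {φ : S → EuclideanSpace ℝ (Fin p)} (hφ : Measurable φ) (hi : Integrable (fun z => ‖φ z‖) G) :
    Integrable (fun t => ∫ z, (1 - Real.cos (inner ℝ (φ z) t)) ∂G) (weightMeasure p) ∧
      ∫ t, ∫ z, (1 - Real.cos (inner ℝ (φ z) t)) ∂G ∂(weightMeasure p) =
        cConst p * ∫ z, ‖φ z‖ ∂G := by
  have hprod : Integrable
      (Function.uncurry fun t z => 1 - Real.cos (inner ℝ (φ z) t)) ((weightMeasure p).prod G) := by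
    rw [integrable_prod_iff']
    · refine ⟨Eventually.of_forall fun z => (integrable_one_sub_cos (φ z)).1, ?_⟩
      refine (hi.const_mul (cConst p)).congr (Eventually.of_forall fun z => ?_)
      simp only [Function.uncurry, ← (integrable_one_sub_cos (φ z)).2]
      refine integral_congr_ae (Eventually.of_forall fun t => ?_)
      exact (Real.norm_of_nonneg (sub_nonneg.2 (Real.cos_le_one _))).symm
    · refine Measurable.aestronglyMeasurable ?_
      unfold Function.uncurry
      fun_prop
  refine ⟨hprod.integral_prod_left, ?_⟩
  rw [integral_integral_swap hprod, ← integral_const_mul]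
  exact integral_congr_ae (Eventually.of_forall fun z => (integrable_one_sub_cos (φ z)).2)

variable (F : Measure (EuclideanSpace ℝ (Fin p)))

lemma integrable_char (s : EuclideanSpace ℝ (Fin p)) {S : Type*} [MeasurableSpace S] (G : Measure S)
    [IsFiniteMeasure G] {φ : S → EuclideanSpace ℝ (Fin p)} (hφ : Measurable φ) :
    Integrable (fun z => Complex.exp ((inner ℝ (φ z) s : ℝ) * Complex.I)) G := by
  refine Integrable.of_bound (Measurable.aestronglyMeasurable (by fun_prop)) 1
    (Eventually.of_forall fun z => ?_)
  rw [Complex.norm_exp_ofReal_mul_I]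

lemma integrable_cos_inner (s : EuclideanSpace ℝ (Fin p)) {S : Type*} [MeasurableSpace S]
    (G : Measure S) [IsFiniteMeasure G] {φ : S → EuclideanSpace ℝ (Fin p)} (hφ : Measurable φ) :
    Integrable (fun z => Real.cos (inner ℝ (φ z) s)) G := by
  refine Integrable.of_bound (Measurable.aestronglyMeasurable (by fun_prop)) 1
    (Eventually.of_forall fun z => ?_)
  exact Real.abs_cos_le_one _

lemma char_mul_conj_char (x y s : EuclideanSpace ℝ (Fin p)) :
    Complex.exp ((inner ℝ x s : ℝ) * Complex.I) *
      (starRingEnd ℂ) (Complex.exp ((inner ℝ y s : ℝ) * Complex.I)) =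
      Complex.exp ((inner ℝ (x - y) s : ℝ) * Complex.I) := by
  rw [← Complex.exp_conj, ← Complex.exp_add, inner_sub_left]
  congr 1
  simp
  ring

/-- Expand |e - f|² with |e| = 1; the cross term and |f|² are means of cosines over F and F × F. The
form 2(1 - ·) - (1 - ·) is used because 1 - cos, unlike cos itself, has a finite integral against
the weight. -/
lemma norm_sq_ctrChar [IsProbabilityMeasure F] (x s : EuclideanSpace ℝ (Fin p)) :
    ‖ctrChar F x s‖ ^ 2 = 2 * ∫ y, (1 - Real.cos (inner ℝ (x - y) s)) ∂F -
      ∫ w : EuclideanSpace ℝ (Fin p) × EuclideanSpace ℝ (Fin p),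
        (1 - Real.cos (inner ℝ (w.1 - w.2) s)) ∂(F.prod F) := by
  have h1 : (Complex.exp ((inner ℝ x s : ℝ) * Complex.I) *
      (starRingEnd ℂ) (charFun F s)).re = ∫ y, Real.cos (inner ℝ (x - y) s) ∂F := by
    rw [charFun_apply, ← integral_conj, ← integral_const_mul]
    simp_rw [char_mul_conj_char]
    rw [← RCLike.re_to_complex, ← integral_re (integrable_char s F (by fun_prop))]
    simp only [RCLike.re_to_complex, Complex.exp_ofReal_mul_I_re]
  have h2 : ‖charFun F s‖ ^ 2 =
      ∫ w : EuclideanSpace ℝ (Fin p) × EuclideanSpace ℝ (Fin p),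
        Real.cos (inner ℝ (w.1 - w.2) s) ∂(F.prod F) := by
    rw [← Complex.ofReal_re (‖charFun F s‖ ^ 2), Complex.ofReal_pow, ← Complex.mul_conj',
      charFun_apply, ← integral_conj, ← integral_prod_mul]
    simp_rw [char_mul_conj_char]
    rw [← RCLike.re_to_complex, ← integral_re (integrable_char s (F.prod F) (by fun_prop))]
    simp only [RCLike.re_to_complex, Complex.exp_ofReal_mul_I_re]
  rw [integral_sub (by simp) (integrable_cos_inner s F (by fun_prop)),
    integral_sub (by simp) (integrable_cos_inner s (F.prod F) (by fun_prop)), ← h1, ← h2,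
    ctrChar, ← Complex.normSq_eq_norm_sq, Complex.normSq_sub, Complex.normSq_eq_norm_sq,
    Complex.normSq_eq_norm_sq, Complex.norm_exp_ofReal_mul_I]
  simp
  ring

lemma integrable_norm_sub_right [IsProbabilityMeasure F] (hF : Integrable (fun x => ‖x‖) F)
    (x : EuclideanSpace ℝ (Fin p)) :
    Integrable (fun y => ‖x - y‖) F := by
  refine ((integrable_const ‖x‖).add hF).mono' (by fun_prop) (Eventually.of_forall fun y => ?_)
  rw [norm_norm]
  exact norm_sub_le _ _

lemma integrable_norm_sub_prod [IsProbabilityMeasure F] (hF : Integrable (fun x => ‖x‖) F) :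
    Integrable (fun w : EuclideanSpace ℝ (Fin p) × EuclideanSpace ℝ (Fin p) => ‖w.1 - w.2‖)
      (F.prod F) := by
  refine ((hF.comp_fst F).add (hF.comp_snd F)).mono' (by fun_prop)
    (Eventually.of_forall fun y => ?_)
  rw [norm_norm]
  exact norm_sub_le _ _

lemma integrable_norm_sq_ctrChar [IsProbabilityMeasure F] (hF : Integrable (fun x => ‖x‖) F)
    (x : EuclideanSpace ℝ (Fin p)) :
    Integrable (fun s => ‖ctrChar F x s‖ ^ 2) (weightMeasure p) ∧
      ∫ s, ‖ctrChar F x s‖ ^ 2 ∂(weightMeasure p) = cConst p * (2 * psi4 F x - gini F) := by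
  have h1 := integrable_integral_one_sub_cos F (φ := fun y => x - y) (by fun_prop)
    (integrable_norm_sub_right F hF x)
  have h2 := integrable_integral_one_sub_cos (F.prod F)
    (φ := fun w : EuclideanSpace ℝ (Fin p) × EuclideanSpace ℝ (Fin p) => w.1 - w.2) (by fun_prop)
    (integrable_norm_sub_prod F hF)
  simp_rw [norm_sq_ctrChar]
  refine ⟨(h1.1.const_mul 2).sub h2.1, ?_⟩
  rw [integral_sub (h1.1.const_mul 2) h2.1, integral_const_mul, h1.2, h2.2, psi4, gini]
  ring

lemma measurable_charFun [IsProbabilityMeasure F] : Measurable (charFun F) := by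
  have : StronglyMeasurable fun s => ∫ x, Complex.exp ((inner ℝ x s : ℝ) * Complex.I) ∂F := by
    refine StronglyMeasurable.integral_prod_right' (f := fun w : EuclideanSpace ℝ (Fin p) ×
      EuclideanSpace ℝ (Fin p) => Complex.exp ((inner ℝ w.2 w.1 : ℝ) * Complex.I)) ?_
    exact Measurable.stronglyMeasurable (by fun_prop)
  exact this.measurable

lemma Measurable.ctrChar [IsProbabilityMeasure F] {S : Type*} [MeasurableSpace S]
    {f g : S → EuclideanSpace ℝ (Fin p)} (hf : Measurable f) (hg : Measurable g) :
    Measurable fun a => ctrChar F (f a) (g a) := by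
  have := (measurable_charFun F).comp hg
  unfold _root_.ctrChar
  exact Measurable.sub (by fun_prop) this

lemma integral_weightMeasure_comp_neg (f : EuclideanSpace ℝ (Fin p) → ℂ) :
    ∫ s, f (-s) ∂(weightMeasure p) = ∫ s, f s ∂(weightMeasure p) := by
  have hm : AEMeasurable (fun t : EuclideanSpace ℝ (Fin p) => ENNReal.ofReal (1 / ‖t‖ ^ (p + 1)))
      volume := by fun_prop
  have ht : ∀ᵐ t : EuclideanSpace ℝ (Fin p), ENNReal.ofReal (1 / ‖t‖ ^ (p + 1)) < ⊤ :=
    Eventually.of_forall fun t => ENNReal.ofReal_lt_top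
  rw [weightMeasure, integral_withDensity_eq_integral_toReal_smul₀ hm ht,
    integral_withDensity_eq_integral_toReal_smul₀ hm ht,
    ← integral_neg_eq_self (fun s => (ENNReal.ofReal (1 / ‖s‖ ^ (p + 1))).toReal • f s)]
  simp_rw [norm_neg]

lemma ctrChar_neg (x s : EuclideanSpace ℝ (Fin p)) :
    ctrChar F x (-s) = (starRingEnd ℂ) (ctrChar F x s) := by
  rw [ctrChar, ctrChar, map_sub, charFun_neg, ← Complex.exp_conj, inner_neg_right]
  simp

/-- Polarisation: the characteristic function cancels in the difference of two centred characters,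
whose squared modulus is 2(1 - cos⟨x-y,s⟩). -/
lemma re_ctrChar_mul_conj (x y s : EuclideanSpace ℝ (Fin p)) :
    (ctrChar F x s * (starRingEnd ℂ) (ctrChar F y s)).re =
      (‖ctrChar F x s‖ ^ 2 + ‖ctrChar F y s‖ ^ 2) / 2 - (1 - Real.cos (inner ℝ (x - y) s)) := by
  have h1 : ‖ctrChar F x s - ctrChar F y s‖ ^ 2 = 2 * (1 - Real.cos (inner ℝ (x - y) s)) := by
    have : ctrChar F x s - ctrChar F y s = Complex.exp ((inner ℝ x s : ℝ) * Complex.I) -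
        Complex.exp ((inner ℝ y s : ℝ) * Complex.I) := by
      rw [ctrChar, ctrChar]; ring
    rw [this, ← Complex.normSq_eq_norm_sq, Complex.normSq_sub, Complex.normSq_eq_norm_sq,
      Complex.normSq_eq_norm_sq, Complex.norm_exp_ofReal_mul_I, Complex.norm_exp_ofReal_mul_I,
      char_mul_conj_char, Complex.exp_ofReal_mul_I_re]
    ring
  rw [← Complex.normSq_eq_norm_sq, Complex.normSq_sub, Complex.normSq_eq_norm_sq,
    Complex.normSq_eq_norm_sq] at h1
  linarith

/-- The value comes from polarisation and the norm representation. The L¹ bound, from 2|zw| ≤ |z|² +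
|w|², supplies the domination for Fubini in `distVar_eq_integral_ctrDist_sq`. -/
lemma integrable_ctrChar_mul_conj [IsProbabilityMeasure F] (hF : Integrable (fun x => ‖x‖) F)
    (x y : EuclideanSpace ℝ (Fin p)) :
    Integrable (fun s => ctrChar F x s * (starRingEnd ℂ) (ctrChar F y s)) (weightMeasure p) ∧
      ∫ s, ‖ctrChar F x s * (starRingEnd ℂ) (ctrChar F y s)‖ ∂(weightMeasure p) ≤
        cConst p * (psi4 F x + psi4 F y - gini F) ∧
      ∫ s, ctrChar F x s * (starRingEnd ℂ) (ctrChar F y s) ∂(weightMeasure p) =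
        ((-(cConst p * ctrDist F x y) : ℝ) : ℂ) := by
  obtain ⟨hx, hxi⟩ := integrable_norm_sq_ctrChar F hF x
  obtain ⟨hy, hyi⟩ := integrable_norm_sq_ctrChar F hF y
  obtain ⟨hc, hci⟩ := integrable_one_sub_cos (x - y)
  have hm : AEStronglyMeasurable (fun s => ctrChar F x s * (starRingEnd ℂ) (ctrChar F y s))
      (weightMeasure p) := by
    simp_rw [← ctrChar_neg]
    exact ((measurable_const.ctrChar F measurable_id).mul
      (measurable_const.ctrChar F measurable_neg)).aestronglyMeasurable
  have hb : ∀ s, ‖ctrChar F x s * (starRingEnd ℂ) (ctrChar F y s)‖ ≤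
      (‖ctrChar F x s‖ ^ 2 + ‖ctrChar F y s‖ ^ 2) / 2 := by
    intro s
    rw [norm_mul, RCLike.norm_conj]
    linarith [two_mul_le_add_sq ‖ctrChar F x s‖ ‖ctrChar F y s‖]
  have hxy : Integrable (fun s => (‖ctrChar F x s‖ ^ 2 + ‖ctrChar F y s‖ ^ 2) / 2)
      (weightMeasure p) := (hx.add hy).div_const 2
  have hint : Integrable (fun s => ctrChar F x s * (starRingEnd ℂ) (ctrChar F y s))
      (weightMeasure p) := hxy.mono' hm (Eventually.of_forall hb)
  refine ⟨hint, ?_, ?_⟩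
  · refine (integral_mono hint.norm hxy hb).trans (le_of_eq ?_)
    rw [integral_div, integral_add hx hy, hxi, hyi]
    ring
  · refine Complex.ext ?_ ?_
    · rw [← RCLike.re_to_complex, ← integral_re hint]
      simp only [RCLike.re_to_complex, re_ctrChar_mul_conj, Complex.ofReal_re]
      rw [integral_sub hxy hc, integral_div, integral_add hx hy, hxi, hyi,
        hci, ctrDist]
      ring
    · rw [Complex.ofReal_im]
      -- The weight is even and s ↦ -s conjugates the integrand, so the integral is its own
      -- conjugate.
      refine Complex.conj_eq_iff_im.1 ?_
      rw [← integral_conj, ← integral_weightMeasure_comp_neg]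
      refine integral_congr_ae (Eventually.of_forall fun s => ?_)
      simp only [ctrChar_neg, map_mul, Complex.conj_conj]

lemma abs_psi4_sub_le [IsProbabilityMeasure F] (hF : Integrable (fun x => ‖x‖) F) (x y : EuclideanSpace ℝ (Fin p)) :
    |psi4 F x - psi4 F y| ≤ ‖x - y‖ := by
  have hx := integrable_norm_sub_right F hF x
  have hy := integrable_norm_sub_right F hF y
  rw [psi4, psi4, ← integral_sub hx hy]
  have hb : ∀ z, ‖‖x - z‖ - ‖y - z‖‖ ≤ ‖x - y‖ := fun z => by
    simpa using abs_norm_sub_norm_le (x - z) (y - z)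
  simpa using norm_integral_le_of_norm_le_const (μ := F) (Eventually.of_forall hb)

lemma continuous_psi4 [IsProbabilityMeasure F] (hF : Integrable (fun x => ‖x‖) F) : Continuous (psi4 F) := by
  refine (LipschitzWith.of_dist_le_mul (K := 1) fun x y => ?_).continuous
  rw [Real.dist_eq, dist_eq_norm, NNReal.coe_one, one_mul]
  exact abs_psi4_sub_le F hF x y

lemma psi4_nonneg (x : EuclideanSpace ℝ (Fin p)) : 0 ≤ psi4 F x :=
  integral_nonneg fun _ => norm_nonneg _

lemma psi4_le [IsProbabilityMeasure F] (hF : Integrable (fun x => ‖x‖) F) (x : EuclideanSpace ℝ (Fin p)) :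
    psi4 F x ≤ ‖x‖ + ∫ y, ‖y‖ ∂F := by
  have : ∫ y, (‖x‖ + ‖y‖) ∂F = ‖x‖ + ∫ y, ‖y‖ ∂F := by
    rw [integral_add (integrable_const _) hF]; simp
  rw [← this]
  exact integral_mono (integrable_norm_sub_right F hF x) ((integrable_const _).add hF)
    fun y => norm_sub_le _ _

lemma memLp_psi4 [IsProbabilityMeasure F] {q : ENNReal} (hF : Integrable (fun x => ‖x‖) F) (hq : MemLp (fun x => ‖x‖) q F) :
    MemLp (psi4 F) q F := by
  refine (hq.add (memLp_const (∫ y, ‖y‖ ∂F))).of_le (continuous_psi4 F hF).aestronglyMeasurable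
    (Eventually.of_forall fun x => ?_)
  rw [Real.norm_of_nonneg (psi4_nonneg F x)]
  exact (psi4_le F hF x).trans (le_abs_self _)

lemma gini_nonneg : 0 ≤ gini F := integral_nonneg fun _ => norm_nonneg _

lemma integral_ctrChar_mul [IsProbabilityMeasure F] (s t : EuclideanSpace ℝ (Fin p)) :
    ∫ x, ctrChar F x s * ctrChar F x t ∂F =
      charFun F (s + t) - charFun F s * charFun F t := by
  have hs := integrable_char s F (φ := fun x => x) measurable_id
  have ht := integrable_char t F (φ := fun x => x) measurable_id
  have hst := integrable_char (s + t) F (φ := fun x => x) measurable_id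
  have h1 : ∀ x : EuclideanSpace ℝ (Fin p), ctrChar F x s * ctrChar F x t =
      (Complex.exp ((inner ℝ x (s + t) : ℝ) * Complex.I) -
        Complex.exp ((inner ℝ x s : ℝ) * Complex.I) * charFun F t) -
      (Complex.exp ((inner ℝ x t : ℝ) * Complex.I) * charFun F s - charFun F s * charFun F t) := by
    intro x
    rw [ctrChar, ctrChar, inner_add_right, Complex.ofReal_add, add_mul, Complex.exp_add]
    ring
  simp_rw [h1]
  rw [integral_sub, integral_sub hst (hs.mul_const _),
    integral_sub (ht.mul_const _) (integrable_const _),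
    integral_mul_const, integral_mul_const, ← charFun_apply, ← charFun_apply, ← charFun_apply]
  · simp [mul_comm]
  · exact hst.sub (hs.mul_const _)
  · exact (ht.mul_const _).sub (integrable_const _)

/-- The distance variance is the second moment of the doubly centred distance. -/
lemma distVar_eq_integral_ctrDist_sq [IsProbabilityMeasure F] (hF : Integrable (fun x => ‖x‖) F)
    (hF2 : MemLp (fun x => ‖x‖) 2 F) :
    distVar F = ∫ w, ctrDist F w.1 w.2 ^ 2 ∂(F.prod F) := by
  have hmeas : Measurable fun v : (EuclideanSpace ℝ (Fin p) × EuclideanSpace ℝ (Fin p)) ×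
      (EuclideanSpace ℝ (Fin p) × EuclideanSpace ℝ (Fin p)) =>
      (ctrChar F v.2.1 v.1.1 * (starRingEnd ℂ) (ctrChar F v.2.2 v.1.1)) *
      (ctrChar F v.2.1 v.1.2 * (starRingEnd ℂ) (ctrChar F v.2.2 v.1.2)) := by
    simp_rw [← ctrChar_neg]
    refine Measurable.mul (Measurable.mul ?_ ?_) (Measurable.mul ?_ ?_)
    · exact measurable_snd.fst.ctrChar F measurable_fst.fst
    · exact measurable_snd.snd.ctrChar F measurable_fst.fst.neg
    · exact measurable_snd.fst.ctrChar F measurable_fst.snd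
    · exact measurable_snd.snd.ctrChar F measurable_fst.snd.neg
  have hp4 := memLp_psi4 F hF hF2
  have hint : Integrable (Function.uncurry fun (s x : EuclideanSpace ℝ (Fin p) ×
      EuclideanSpace ℝ (Fin p)) =>
      (ctrChar F x.1 s.1 * (starRingEnd ℂ) (ctrChar F x.2 s.1)) *
      (ctrChar F x.1 s.2 * (starRingEnd ℂ) (ctrChar F x.2 s.2)))
      (((weightMeasure p).prod (weightMeasure p)).prod (F.prod F)) := by
    refine (integrable_prod_iff' hmeas.aestronglyMeasurable).2 ⟨Eventually.of_forall fun x => ?_, ?_⟩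
    · have h := (integrable_ctrChar_mul_conj F hF x.1 x.2).1
      exact h.mul_prod h
    -- For fixed sample points the integral of the norm over both frequencies is the square of a
    -- one-frequency L¹ norm; this is where second moments are needed.
    · have hb : Integrable (fun x : EuclideanSpace ℝ (Fin p) × EuclideanSpace ℝ (Fin p) =>
          (cConst p * (psi4 F x.1 + psi4 F x.2)) ^ 2) (F.prod F) :=
        (((hp4.comp_fst F).add (hp4.comp_snd F)).const_mul (cConst p)).integrable_sq
      refine hb.mono' hmeas.stronglyMeasurable.norm.integral_prod_left'.aestronglyMeasurable
        (Eventually.of_forall fun x => ?_)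
      rw [Real.norm_of_nonneg (integral_nonneg fun _ => norm_nonneg _)]
      simp only [norm_mul _ (_ * _)]
      rw [integral_prod_mul
        (fun s => ‖ctrChar F x.1 s * (starRingEnd ℂ) (ctrChar F x.2 s)‖)
        (fun s => ‖ctrChar F x.1 s * (starRingEnd ℂ) (ctrChar F x.2 s)‖), ← sq]
      refine pow_le_pow_left₀ (integral_nonneg fun _ => norm_nonneg _) ?_ 2
      refine (integrable_ctrChar_mul_conj F hF x.1 x.2).2.1.trans ?_
      exact mul_le_mul_of_nonneg_left (by linarith [gini_nonneg F]) (cConst_pos p).le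
  have hswap := integral_integral_swap hint
  -- Integrating the sample points first gives |Cov|², a covariance times its conjugate. Integrating
  -- the frequencies first gives (-c_p a)², so the sign disappears.
  have hL : ∀ s : EuclideanSpace ℝ (Fin p) × EuclideanSpace ℝ (Fin p),
      ∫ x : EuclideanSpace ℝ (Fin p) × EuclideanSpace ℝ (Fin p),
        (ctrChar F x.1 s.1 * (starRingEnd ℂ) (ctrChar F x.2 s.1)) *
        (ctrChar F x.1 s.2 * (starRingEnd ℂ) (ctrChar F x.2 s.2)) ∂(F.prod F) =
      ((‖charFun F (s.1 + s.2) - charFun F s.1 * charFun F s.2‖ ^ 2 : ℝ) : ℂ) := by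
    intro s
    rw [Complex.ofReal_pow, ← Complex.mul_conj', ← integral_ctrChar_mul, ← integral_conj,
      ← integral_prod_mul]
    refine integral_congr_ae (Eventually.of_forall fun x => ?_)
    simp only [map_mul]
    ring
  have hR : ∀ x : EuclideanSpace ℝ (Fin p) × EuclideanSpace ℝ (Fin p),
      ∫ s : EuclideanSpace ℝ (Fin p) × EuclideanSpace ℝ (Fin p),
        (ctrChar F x.1 s.1 * (starRingEnd ℂ) (ctrChar F x.2 s.1)) *
        (ctrChar F x.1 s.2 * (starRingEnd ℂ) (ctrChar F x.2 s.2))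
          ∂((weightMeasure p).prod (weightMeasure p)) =
      ((cConst p ^ 2 * ctrDist F x.1 x.2 ^ 2 : ℝ) : ℂ) := by
    intro x
    rw [integral_prod_mul
      (fun s => ctrChar F x.1 s * (starRingEnd ℂ) (ctrChar F x.2 s))
      (fun s => ctrChar F x.1 s * (starRingEnd ℂ) (ctrChar F x.2 s)),
      (integrable_ctrChar_mul_conj F hF x.1 x.2).2.2, ← Complex.ofReal_mul]
    congr 1
    ring
  simp_rw [hL, hR, integral_complex_ofReal] at hswap
  have hreal := Complex.ofReal_injective hswap
  rw [integral_const_mul, weightMeasure, prod_withDensity (by fun_prop) (by fun_prop),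
    integral_withDensity_eq_integral_toReal_smul₀ (by fun_prop)
      (Eventually.of_forall fun t => ENNReal.mul_lt_top ENNReal.ofReal_lt_top
        ENNReal.ofReal_lt_top)] at hreal
  have hc := cConst_pos p
  have hgoal : ∫ w : EuclideanSpace ℝ (Fin p) × EuclideanSpace ℝ (Fin p),
      ‖charFun F (w.1 + w.2) - charFun F w.1 * charFun F w.2‖ ^ 2 /
        (‖w.1‖ ^ (p + 1) * ‖w.2‖ ^ (p + 1)) =
      cConst p ^ 2 * ∫ w, ctrDist F w.1 w.2 ^ 2 ∂(F.prod F) := by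
    rw [← hreal]
    refine integral_congr_ae (Eventually.of_forall fun w => ?_)
    simp only [smul_eq_mul, ENNReal.toReal_mul]
    rw [ENNReal.toReal_ofReal (by positivity), ENNReal.toReal_ofReal (by positivity)]
    rw [div_eq_mul_inv, mul_inv]
    ring
  rw [distVar, hgoal]
  field_simp

end DistVar

/-! ### Second moments of degenerate double sums -/

section Degenerate

variable {Ω S T ι : Type*} [MeasurableSpace Ω] [MeasurableSpace S] [MeasurableSpace T]
  {P : Measure Ω} [IsProbabilityMeasure P] {F : Measure S}

lemma integral_comp_eq_zero_of_indepFun [IsProbabilityMeasure F] {U : Ω → S} {V : Ω → T} (hU : HasLaw U F P)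
    (hV : AEMeasurable V P) (hUV : IndepFun V U P) {φ : T × S → ℝ} (hφ : Measurable φ)
    (h0 : ∀ v, ∫ u, φ (v, u) ∂F = 0) : ∫ ω, φ (V ω, U ω) ∂P = 0 := by
  -- Without integrability the Bochner integral is 0 by convention, so no moment assumption is
  -- needed.
  by_cases hi : Integrable (fun ω => φ (V ω, U ω)) P
  swap
  · exact integral_undef hi
  have hlaw : P.map (fun ω => (V ω, U ω)) = (P.map V).prod F := by
    rw [hUV.map_prod_eq_prod_map_map hV hU.aemeasurable, hU.map_eq]
  have hVU : AEMeasurable (fun ω => (V ω, U ω)) P := hV.prodMk hU.aemeasurable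
  have hi' : Integrable φ ((P.map V).prod F) := by
    rw [← hlaw, integrable_map_measure hφ.aestronglyMeasurable hVU]
    exact hi
  rw [← integral_map (φ := fun ω => (V ω, U ω)) hVU hφ.aestronglyMeasurable, hlaw,
    integral_prod _ hi']
  simp [h0]

variable {X : ι → Ω → S} (hlaw : ∀ i, HasLaw (X i) F P) (hindep : iIndepFun X P)

include hlaw hindep

lemma hasLaw_prodMk {i j : ι} (hij : i ≠ j) :
    HasLaw (fun ω => (X i ω, X j ω)) (F.prod F) P :=
  (hindep.indepFun hij).hasLaw_prod (hlaw i) (hlaw j)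

variable {h : S → S → ℝ}

lemma memLp_comp_pair (h2 : MemLp (Function.uncurry h) 2 (F.prod F))
    (hd : MemLp (fun x => h x x) 2 F) (i j : ι) :
    MemLp (fun ω => h (X i ω) (X j ω)) 2 P := by
  rcases eq_or_ne i j with rfl | hij
  · rw [← (hlaw i).map_eq] at hd
    exact hd.comp_of_map (hlaw i).aemeasurable
  · have hl := hasLaw_prodMk hlaw hindep hij
    rw [← hl.map_eq] at h2
    exact h2.comp_of_map hl.aemeasurable

variable (hm : Measurable (Function.uncurry h))
include hm

/-- Diagonal pairs have a different law from off-diagonal ones; the sum of the two second moments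
serves for both. -/
lemma integral_sq_comp_pair_le (i j : ι) :
    ∫ ω, h (X i ω) (X j ω) ^ 2 ∂P ≤
      ∫ w, h w.1 w.2 ^ 2 ∂(F.prod F) + ∫ x, h x x ^ 2 ∂F := by
  have p1 : 0 ≤ ∫ w, h w.1 w.2 ^ 2 ∂(F.prod F) := integral_nonneg fun _ => sq_nonneg _
  have p2 : 0 ≤ ∫ x, h x x ^ 2 ∂F := integral_nonneg fun _ => sq_nonneg _
  rcases eq_or_ne i j with rfl | hij
  · have hmd : Measurable fun x => h x x ^ 2 :=
      (hm.comp (measurable_id.prodMk measurable_id)).pow_const 2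
    have := (hlaw i).integral_comp hmd.aestronglyMeasurable
    simp only [Function.comp_def] at this
    linarith
  · have hl := hasLaw_prodMk hlaw hindep hij
    have := hl.integral_comp (f := fun w => h w.1 w.2 ^ 2)
      (hm.pow_const 2).aestronglyMeasurable
    simp only [Function.comp_def] at this
    linarith

variable (h2 : MemLp (Function.uncurry h) 2 (F.prod F)) (hd : MemLp (fun x => h x x) 2 F)
include h2 hd

lemma integral_mul_le_of_memLp (i j k l : ι) :
    ∫ ω, h (X i ω) (X j ω) * h (X k ω) (X l ω) ∂P ≤
      ∫ w, h w.1 w.2 ^ 2 ∂(F.prod F) + ∫ x, h x x ^ 2 ∂F := by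
  have hL := memLp_comp_pair hlaw hindep h2 hd
  have hB := integral_sq_comp_pair_le hlaw hindep hm
  have h1 : ∫ ω, h (X i ω) (X j ω) * h (X k ω) (X l ω) ∂P ≤
      ∫ ω, (h (X i ω) (X j ω) ^ 2 + h (X k ω) (X l ω) ^ 2) / 2 ∂P := by
    refine integral_mono ((hL i j).integrable_mul (hL k l))
      (((hL i j).integrable_sq.add (hL k l).integrable_sq).div_const 2) fun ω => ?_
    have := two_mul_le_add_sq (h (X i ω) (X j ω)) (h (X k ω) (X l ω))
    linarith
  rw [integral_div, integral_add (hL i j).integrable_sq (hL k l).integrable_sq] at h1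
  linarith [hB i j, hB k l]

variable [IsProbabilityMeasure F] (hsymm : ∀ x y, h x y = h y x)
  (hdeg : ∀ x, ∫ y, h x y ∂F = 0)
include hsymm hdeg

omit h2 hd in
-- An index occurring once can be integrated out first, which gives zero by degeneracy. Since j, k,
-- l may coincide, they enter through the finset they span.
lemma integral_mul_eq_zero_of_degenerate {a j k l : ι} (haj : a ≠ j) (hak : a ≠ k) (hal : a ≠ l) :
    ∫ ω, h (X a ω) (X j ω) * h (X k ω) (X l ω) ∂P = 0 := by
  classical
  have hae : ∀ i, AEMeasurable (X i) P := fun i => (hlaw i).aemeasurable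
  have hind := hindep.indepFun_finset₀ {j, k, l} {a} (by simp; tauto) hae
  have hV : AEMeasurable (fun ω (i : ({j, k, l} : Finset ι)) => X i ω) P :=
    aemeasurable_pi_lambda _ fun i => hae i
  have hind' : IndepFun (fun ω (i : ({j, k, l} : Finset ι)) => X i ω) (X a) P :=
    hind.comp (φ := id) (ψ := fun v : ({a} : Finset ι) → S => v ⟨a, by simp⟩) measurable_id
      (measurable_pi_apply (⟨a, by simp⟩ : ({a} : Finset ι)))
  refine integral_comp_eq_zero_of_indepFun (hlaw a) hV hind'
    (φ := fun w => h w.2 (w.1 ⟨j, by simp⟩) * h (w.1 ⟨k, by simp⟩) (w.1 ⟨l, by simp⟩)) ?_ ?_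
  · have m (i : ({j, k, l} : Finset ι)) :
        Measurable fun w : (({j, k, l} : Finset ι) → S) × S => w.1 i :=
      (measurable_pi_apply i).comp measurable_fst
    exact (hm.comp (measurable_snd.prodMk (m _))).mul (hm.comp ((m _).prodMk (m _)))
  · intro v
    simp only
    rw [integral_mul_const]
    simp_rw [fun u => hsymm u (v ⟨j, by simp⟩), hdeg, zero_mul]

/-- The second moment of a degenerate double sum is of the order of the number of pairs. -/
lemma integral_sq_sum_sum_le [Fintype ι] :
    ∫ ω, (∑ i, ∑ j, h (X i ω) (X j ω)) ^ 2 ∂P ≤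
      3 * (∫ w, h w.1 w.2 ^ 2 ∂(F.prod F) + ∫ x, h x x ^ 2 ∂F) * (Fintype.card ι : ℝ) ^ 2 := by
  classical
  set C := ∫ w, h w.1 w.2 ^ 2 ∂(F.prod F) + ∫ x, h x x ^ 2 ∂F with hC
  have hC0 : 0 ≤ C := add_nonneg (integral_nonneg fun _ => sq_nonneg _)
    (integral_nonneg fun _ => sq_nonneg _)
  have hL := memLp_comp_pair hlaw hindep h2 hd
  have hint : ∀ i j k l, Integrable (fun ω => h (X i ω) (X j ω) * h (X k ω) (X l ω)) P :=
    fun i j k l => (hL i j).integrable_mul (hL k l)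
  have hexp : ∀ ω, (∑ i, ∑ j, h (X i ω) (X j ω)) ^ 2 =
      ∑ i, ∑ j, ∑ k, ∑ l, h (X i ω) (X j ω) * h (X k ω) (X l ω) := by
    intro ω
    rw [sq, Finset.sum_mul]
    refine Finset.sum_congr rfl fun i _ => ?_
    rw [Finset.sum_mul]
    refine Finset.sum_congr rfl fun j _ => ?_
    rw [Finset.mul_sum]
    refine Finset.sum_congr rfl fun k _ => ?_
    rw [Finset.mul_sum]
  have hzero : ∀ a j k l : ι, a ≠ j → a ≠ k → a ≠ l →
      ∫ ω, h (X a ω) (X j ω) * h (X k ω) (X l ω) ∂P = 0 := fun a j k l h1 h2 h3 =>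
    integral_mul_eq_zero_of_degenerate hlaw hindep hm hsymm hdeg h1 h2 h3
  -- A product can survive only if no index occurs alone, and then the four indices match up in one
  -- of three pairings. Each pairing accounts for (card ι)² terms, hence the factor 3.
  have hterm : ∀ i j k l, ∫ ω, h (X i ω) (X j ω) * h (X k ω) (X l ω) ∂P ≤
      (if i = j then if k = l then C else 0 else 0) +
      (if i = k then if j = l then C else 0 else 0) +
      (if i = l then if j = k then C else 0 else 0) := by
    intro i j k l
    have hle := integral_mul_le_of_memLp hlaw hindep hm h2 hd i j k l
    have q1 : 0 ≤ (if i = j then if k = l then C else 0 else 0) := by split_ifs <;> simp [hC0]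
    have q2 : 0 ≤ (if i = k then if j = l then C else 0 else 0) := by split_ifs <;> simp [hC0]
    have q3 : 0 ≤ (if i = l then if j = k then C else 0 else 0) := by split_ifs <;> simp [hC0]
    by_cases c1 : i = j ∧ k = l
    · rw [if_pos c1.1, if_pos c1.2]; linarith
    by_cases c2 : i = k ∧ j = l
    · rw [if_pos c2.1, if_pos c2.2]; linarith
    by_cases c3 : i = l ∧ j = k
    · rw [if_pos c3.1, if_pos c3.2]; linarith
    suffices h0 : ∫ ω, h (X i ω) (X j ω) * h (X k ω) (X l ω) ∂P = 0 by
      rw [h0]; linarith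
    -- Symmetry of the kernel and commutativity move the lone index to the first slot, whichever it
    -- is.
    by_cases u1 : i ≠ j ∧ i ≠ k ∧ i ≠ l
    · exact hzero i j k l u1.1 u1.2.1 u1.2.2
    by_cases u2 : j ≠ i ∧ j ≠ k ∧ j ≠ l
    · simp_rw [fun ω => hsymm (X i ω) (X j ω)]
      exact hzero j i k l u2.1 u2.2.1 u2.2.2
    by_cases u3 : k ≠ l ∧ k ≠ i ∧ k ≠ j
    · simp_rw [fun ω => mul_comm (h (X i ω) (X j ω))]
      exact hzero k l i j u3.1 u3.2.1 u3.2.2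
    by_cases u4 : l ≠ k ∧ l ≠ i ∧ l ≠ j
    · simp_rw [fun ω => mul_comm (h (X i ω) (X j ω)), fun ω => hsymm (X k ω) (X l ω)]
      exact hzero l k i j u4.1 u4.2.1 u4.2.2
    · exfalso; clear * - c1 c2 c3 u1 u2 u3 u4; grind
  simp_rw [hexp]
  rw [integral_finsetSum _ fun i _ => integrable_finsetSum _ fun j _ =>
    integrable_finsetSum _ fun k _ => integrable_finsetSum _ fun l _ => hint i j k l]
  simp_rw [fun i => integral_finsetSum (μ := P) Finset.univ (fun j _ =>
    integrable_finsetSum Finset.univ fun k _ => integrable_finsetSum Finset.univ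
      fun l _ => hint i j k l)]
  simp_rw [fun i j => integral_finsetSum (μ := P) Finset.univ (fun k _ =>
    integrable_finsetSum Finset.univ fun l _ => hint i j k l)]
  simp_rw [fun i j k => integral_finsetSum (μ := P) Finset.univ (fun l _ => hint i j k l)]
  refine (Finset.sum_le_sum fun i _ => Finset.sum_le_sum fun j _ => Finset.sum_le_sum fun k _ =>
    Finset.sum_le_sum fun l _ => hterm i j k l).trans (le_of_eq ?_)
  simp only [Finset.sum_add_distrib, Finset.sum_ite_eq, Finset.mem_univ, if_true,
    Finset.sum_const, Finset.card_univ, nsmul_eq_mul, Finset.sum_ite_irrel, mul_ite, mul_zero]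
  ring

/-- The second moment of a row of a degenerate double sum is of the order of its length. -/
lemma integral_sq_sum_le [Fintype ι] (i : ι) :
    ∫ ω, (∑ j, h (X i ω) (X j ω)) ^ 2 ∂P ≤
      (∫ w, h w.1 w.2 ^ 2 ∂(F.prod F) + ∫ x, h x x ^ 2 ∂F) * Fintype.card ι := by
  classical
  set C := ∫ w, h w.1 w.2 ^ 2 ∂(F.prod F) + ∫ x, h x x ^ 2 ∂F with hC
  have hL := memLp_comp_pair hlaw hindep h2 hd
  have hint : ∀ j l, Integrable (fun ω => h (X i ω) (X j ω) * h (X i ω) (X l ω)) P :=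
    fun j l => (hL i j).integrable_mul (hL i l)
  have hzero : ∀ a j k l : ι, a ≠ j → a ≠ k → a ≠ l →
      ∫ ω, h (X a ω) (X j ω) * h (X k ω) (X l ω) ∂P = 0 := fun a j k l h1 h2 h3 =>
    integral_mul_eq_zero_of_degenerate hlaw hindep hm hsymm hdeg h1 h2 h3
  have hterm : ∀ j l, ∫ ω, h (X i ω) (X j ω) * h (X i ω) (X l ω) ∂P ≤ if j = l then C else 0 := by
    intro j l
    split_ifs with hjl
    · exact integral_mul_le_of_memLp hlaw hindep hm h2 hd i j i l
    · refine le_of_eq ?_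
      -- For j ≠ l, the lone index is l when j = i, and j otherwise.
      by_cases hji : j = i
      · subst hji
        simp_rw [fun ω => mul_comm (h (X j ω) (X j ω)), fun ω => hsymm (X j ω) (X l ω)]
        exact hzero l j j j (Ne.symm hjl) (Ne.symm hjl) (Ne.symm hjl)
      · simp_rw [fun ω => hsymm (X i ω) (X j ω)]
        exact hzero j i i l hji hji hjl
  simp_rw [sq, Finset.sum_mul, Finset.mul_sum]
  rw [integral_finsetSum _ fun j _ => integrable_finsetSum _ fun l _ => hint j l]
  simp_rw [fun j => integral_finsetSum (μ := P) Finset.univ (fun l _ => hint j l)]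
  refine (Finset.sum_le_sum fun j _ => Finset.sum_le_sum fun l _ => hterm j l).trans (le_of_eq ?_)
  simp only [Finset.sum_ite_eq, Finset.mem_univ, if_true, Finset.sum_const, Finset.card_univ,
    nsmul_eq_mul]
  ring

end Degenerate

/-! ### The doubly centred distance kernel -/

/-- Jensen's inequality for the square, obtained from nonnegativity of the variance on each fibre.
-/
lemma MeasureTheory.MemLp.integral_prod_right_two {S T : Type*} [MeasurableSpace S]
    [MeasurableSpace T] {F : Measure S} [IsFiniteMeasure F] {G : Measure T}
    [IsProbabilityMeasure G] {f : S × T → ℝ} (hf : MemLp f 2 (F.prod G)) :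
    MemLp (fun x => ∫ y, f (x, y) ∂G) 2 F := by
  have hm : AEStronglyMeasurable (fun x => ∫ y, f (x, y) ∂G) F :=
    hf.aestronglyMeasurable.integral_prod_right'
  rw [memLp_two_iff_integrable_sq hm]
  have hsq : Integrable (fun w => f w ^ 2) (F.prod G) := hf.integrable_sq
  refine hsq.integral_prod_left.mono' (hm.pow 2) ?_
  filter_upwards [hsq.prod_right_ae, hf.aestronglyMeasurable.prodMk_left] with x hx hxm
  have hL : MemLp (fun y => f (x, y)) 2 G := (memLp_two_iff_integrable_sq hxm).2 hx
  have hv := variance_nonneg (fun y => f (x, y)) G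
  rw [variance_eq_sub hL] at hv
  rw [Real.norm_of_nonneg (sq_nonneg _)]
  simpa using hv

lemma memLp_two_of_four {S : Type*} [MeasurableSpace S] {μ : Measure S} [IsFiniteMeasure μ]
    {f : S → ℝ} (hf : MemLp f 4 μ) : MemLp f 2 μ := hf.mono_exponent (by norm_num)

lemma MeasureTheory.MemLp.mul_four {S : Type*} [MeasurableSpace S] {μ : Measure S} {f g : S → ℝ}
    (hf : MemLp f 4 μ) (hg : MemLp g 4 μ) : MemLp (fun z => f z * g z) 2 μ := by
  have : ENNReal.HolderTriple 4 4 2 := ⟨by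
    rw [← two_mul, show (4 : ENNReal) = 2 * 2 by norm_num,
      ENNReal.mul_inv (by simp) (by simp), ← mul_assoc, ENNReal.mul_inv_cancel (by simp) (by simp),
      one_mul]⟩
  exact hg.mul hf

lemma memLp_norm_sub {p : ℕ} {S : Type*} [MeasurableSpace S] {μ : Measure S}
    {f g : S → EuclideanSpace ℝ (Fin p)} (hf : MemLp (fun z => ‖f z‖) 4 μ)
    (hg : MemLp (fun z => ‖g z‖) 4 μ) (hfm : Measurable f) (hgm : Measurable g) :
    MemLp (fun z => ‖f z - g z‖) 4 μ :=
  ((memLp_norm_iff hfm.aestronglyMeasurable).1 hf |>.sub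
    ((memLp_norm_iff hgm.aestronglyMeasurable).1 hg)).norm

section Kernel

variable {p : ℕ} (F : Measure (EuclideanSpace ℝ (Fin p)))

/-- The conditional second moment of the doubly centred distance. -/
noncomputable def ctrDistSq (x : EuclideanSpace ℝ (Fin p)) : ℝ := ∫ y, ctrDist F x y ^ 2 ∂F

/-- The completely degenerate part of the squared doubly centred distance. -/
noncomputable def degDistSq (x y : EuclideanSpace ℝ (Fin p)) : ℝ :=
  ctrDist F x y ^ 2 - ctrDistSq F x - ctrDistSq F y + distVar F

lemma ctrDist_comm (x y : EuclideanSpace ℝ (Fin p)) : ctrDist F x y = ctrDist F y x := by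
  rw [ctrDist, ctrDist, norm_sub_rev]; ring

lemma degDistSq_comm (x y : EuclideanSpace ℝ (Fin p)) : degDistSq F x y = degDistSq F y x := by
  rw [degDistSq, degDistSq, ctrDist_comm]; ring

variable [IsProbabilityMeasure F]

lemma psi2_eq (x : EuclideanSpace ℝ (Fin p)) : psi2 F x = psi4 F x ^ 2 := by
  rw [psi2, integral_prod_mul (fun y => ‖x - y‖) (fun y => ‖x - y‖), psi4, sq]

variable (h4 : MemLp (fun x : EuclideanSpace ℝ (Fin p) => ‖x‖) 4 F)
include h4

lemma integrable_norm_of_four : Integrable (fun x => ‖x‖) F :=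
  memLp_one_iff_integrable.1 (h4.mono_exponent (by norm_num))

lemma memLp_psi4_four : MemLp (psi4 F) 4 F := memLp_psi4 F (integrable_norm_of_four F h4) h4

lemma memLp_norm_sub_right (x : EuclideanSpace ℝ (Fin p)) : MemLp (fun y => ‖x - y‖) 4 F :=
  memLp_norm_sub (memLp_const _) h4 measurable_const measurable_id

lemma memLp_norm_sub_prod :
    MemLp (fun w : EuclideanSpace ℝ (Fin p) × EuclideanSpace ℝ (Fin p) => ‖w.1 - w.2‖) 4
      (F.prod F) :=
  memLp_norm_sub (h4.comp_fst F) (h4.comp_snd F) measurable_fst measurable_snd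

lemma memLp_psi1 : MemLp (psi1 F) 2 F := by
  refine MemLp.integral_prod_right_two (G := F)
    (f := fun w : EuclideanSpace ℝ (Fin p) × EuclideanSpace ℝ (Fin p) => ‖w.1 - w.2‖ ^ 2) ?_
  simp_rw [sq]
  exact (memLp_norm_sub_prod F h4).mul_four (memLp_norm_sub_prod F h4)

lemma memLp_psi2 : MemLp (psi2 F) 2 F := by
  simp_rw [funext (psi2_eq F), sq]
  exact (memLp_psi4_four F h4).mul_four (memLp_psi4_four F h4)

lemma memLp_psi3 : MemLp (psi3 F) 2 F := by
  refine MemLp.integral_prod_right_two (G := F.prod F)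
    (f := fun w : EuclideanSpace ℝ (Fin p) × EuclideanSpace ℝ (Fin p) × EuclideanSpace ℝ (Fin p) =>
      ‖w.1 - w.2.1‖ * ‖w.2.1 - w.2.2‖) (MemLp.mul_four ?_ ?_)
  · exact memLp_norm_sub (h4.comp_fst _) ((h4.comp_fst F).comp_snd F) measurable_fst
      measurable_snd.fst
  · exact memLp_norm_sub ((h4.comp_fst F).comp_snd F) ((h4.comp_snd F).comp_snd F)
      measurable_snd.fst measurable_snd.snd

lemma psi3_eq (x : EuclideanSpace ℝ (Fin p)) : psi3 F x = ∫ y, ‖x - y‖ * psi4 F y ∂F := by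
  have hi : Integrable (fun w : EuclideanSpace ℝ (Fin p) × EuclideanSpace ℝ (Fin p) =>
      ‖x - w.1‖ * ‖w.1 - w.2‖) (F.prod F) :=
    (((memLp_norm_sub_right F h4 x).comp_fst F).mul_four
      (memLp_norm_sub_prod F h4)).integrable (by norm_num)
  rw [psi3, integral_prod _ hi]
  simp_rw [integral_const_mul]
  rfl

lemma integral_psi4 : ∫ x, psi4 F x ∂F = gini F := by
  rw [gini, integral_prod _ (integrable_norm_sub_prod F (integrable_norm_of_four F h4))]
  rfl

lemma integral_psi1 : ∫ x, psi1 F x ∂F = popT1 F := by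
  rw [popT1, integral_prod _ (memLp_two_of_four (memLp_norm_sub_prod F h4)).integrable_sq]
  rfl

lemma integral_psi2 : ∫ x, psi2 F x ∂F = popT3 F := by
  have hi : Integrable (fun w : EuclideanSpace ℝ (Fin p) × EuclideanSpace ℝ (Fin p) ×
      EuclideanSpace ℝ (Fin p) => ‖w.1 - w.2.1‖ * ‖w.1 - w.2.2‖) (F.prod (F.prod F)) := by
    refine (MemLp.mul_four ?_ ?_).integrable one_le_two
    · exact memLp_norm_sub (h4.comp_fst _) ((h4.comp_fst F).comp_snd F) measurable_fst
        measurable_snd.fst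
    · exact memLp_norm_sub (h4.comp_fst _) ((h4.comp_snd F).comp_snd F) measurable_fst
        measurable_snd.snd
  rw [popT3, integral_prod _ hi]
  rfl

/-- In the chain x, y, z the middle point plays the centre of `popT3`: integrating out the end point
x first leaves ψ₄(y)² = ψ₂(y). -/
lemma integral_psi3 : ∫ x, psi3 F x ∂F = popT3 F := by
  rw [← integral_psi2 F h4]
  simp_rw [psi3_eq F h4, psi2_eq]
  rw [integral_integral_swap]
  · refine integral_congr_ae (Eventually.of_forall fun y => ?_)
    simp only
    rw [integral_mul_const, sq]
    congr 1
    simp_rw [psi4, norm_sub_rev y]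
  · exact ((memLp_norm_sub_prod F h4).mul_four ((memLp_psi4_four F h4).comp_snd F)).integrable
      one_le_two

lemma continuous_ctrDist :
    Continuous fun w : EuclideanSpace ℝ (Fin p) × EuclideanSpace ℝ (Fin p) =>
      ctrDist F w.1 w.2 := by
  have := continuous_psi4 F (integrable_norm_of_four F h4)
  unfold ctrDist
  fun_prop

lemma memLp_ctrDist :
    MemLp (fun w : EuclideanSpace ℝ (Fin p) × EuclideanSpace ℝ (Fin p) => ctrDist F w.1 w.2) 4
      (F.prod F) :=
  (((memLp_norm_sub_prod F h4).sub ((memLp_psi4_four F h4).comp_fst F)).sub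
    ((memLp_psi4_four F h4).comp_snd F)).add (memLp_const _)

lemma memLp_ctrDist_diag : MemLp (fun x => ctrDist F x x) 4 F := by
  have h := memLp_psi4_four F h4
  have : (fun x => ctrDist F x x) = fun x => gini F - (psi4 F x + psi4 F x) := by
    ext x; rw [ctrDist, sub_self, norm_zero]; ring
  rw [this]
  exact (memLp_const _).sub (h.add h)

lemma integral_ctrDist (x : EuclideanSpace ℝ (Fin p)) : ∫ y, ctrDist F x y ∂F = 0 := by
  have h1 := (memLp_norm_sub_right F h4 x).integrable (by norm_num)
  have h2 := (memLp_psi4_four F h4).integrable (by norm_num)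
  have h3 : Integrable (fun y => ‖x - y‖ - psi4 F x) F := h1.sub (integrable_const _)
  have h5 : Integrable (fun y => ‖x - y‖ - psi4 F x - psi4 F y) F := h3.sub h2
  simp only [ctrDist]
  rw [integral_add h5 (integrable_const _), integral_sub h3 h2, integral_sub h1
    (integrable_const _), integral_psi4 F h4]
  simp [psi4]

lemma distVar_eq : distVar F = ∫ x, ctrDistSq F x ∂F := by
  rw [distVar_eq_integral_ctrDist_sq F (integrable_norm_of_four F h4) (memLp_two_of_four h4),
    integral_prod _ (memLp_two_of_four (memLp_ctrDist F h4)).integrable_sq]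
  rfl

lemma memLp_ctrDist_sq :
    MemLp (fun w : EuclideanSpace ℝ (Fin p) × EuclideanSpace ℝ (Fin p) => ctrDist F w.1 w.2 ^ 2) 2
      (F.prod F) := by
  simp_rw [sq]
  exact (memLp_ctrDist F h4).mul_four (memLp_ctrDist F h4)

lemma memLp_ctrDistSq : MemLp (ctrDistSq F) 2 F := (memLp_ctrDist_sq F h4).integral_prod_right_two

lemma measurable_ctrDistSq : Measurable (ctrDistSq F) :=
  ((continuous_ctrDist F h4).pow 2).stronglyMeasurable.integral_prod_right'.measurable

lemma measurable_degDistSq :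
    Measurable (Function.uncurry (degDistSq F)) := by
  have h1 := ((continuous_ctrDist F h4).pow 2).measurable
  have h2 := measurable_ctrDistSq F h4
  exact ((h1.sub (h2.comp measurable_fst)).sub (h2.comp measurable_snd)).add_const _

lemma memLp_degDistSq : MemLp (Function.uncurry (degDistSq F)) 2 (F.prod F) :=
  (((memLp_ctrDist_sq F h4).sub ((memLp_ctrDistSq F h4).comp_fst F)).sub
    ((memLp_ctrDistSq F h4).comp_snd F)).add (memLp_const _)

lemma memLp_degDistSq_diag : MemLp (fun x => degDistSq F x x) 2 F := by
  have h := memLp_ctrDist_diag F h4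
  have h2 : MemLp (fun x => ctrDist F x x ^ 2) 2 F := by
    simp_rw [sq]
    exact h.mul_four h
  exact ((h2.sub (memLp_ctrDistSq F h4)).sub (memLp_ctrDistSq F h4)).add (memLp_const _)

lemma integrable_ctrDist_sq_right (x : EuclideanSpace ℝ (Fin p)) :
    Integrable (fun y => ctrDist F x y ^ 2) F := by
  have h : MemLp (fun y => ctrDist F x y) 4 F :=
    (((memLp_norm_sub_right F h4 x).sub (memLp_const _)).sub (memLp_psi4_four F h4)).add
      (memLp_const _)
  exact (memLp_two_of_four h).integrable_sq

lemma integral_degDistSq (x : EuclideanSpace ℝ (Fin p)) : ∫ y, degDistSq F x y ∂F = 0 := by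
  have h1 := integrable_ctrDist_sq_right F h4 x
  have h2 := (memLp_ctrDistSq F h4).integrable one_le_two
  have h3 : Integrable (fun y => ctrDist F x y ^ 2 - ctrDistSq F x) F := h1.sub (integrable_const _)
  have h5 : Integrable (fun y => ctrDist F x y ^ 2 - ctrDistSq F x - ctrDistSq F y) F := h3.sub h2
  simp only [degDistSq]
  rw [integral_add h5 (integrable_const _), integral_sub h3 h2, integral_sub h1
    (integrable_const _), ← distVar_eq F h4]
  simp [ctrDistSq]

/-- Expand (‖x-y‖ - ψ₄(y) - b)² with b = ψ₄(x) - Δ. The mixed term in ‖x-y‖ψ₄(y) gives ψ₃, and the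
terms in b collapse to -b² = -ψ₂(x) + 2Δψ₄(x) - Δ². -/
lemma ctrDistSq_eq (x : EuclideanSpace ℝ (Fin p)) :
    ctrDistSq F x = (psi1 F x - psi2 F x - 2 * psi3 F x) + 2 * gini F * psi4 F x +
      (∫ y, psi4 F y ^ 2 ∂F - gini F ^ 2) := by
  have hd := memLp_norm_sub_right F h4 x
  have hp := memLp_psi4_four F h4
  have i1 := (memLp_two_of_four hd).integrable_sq
  have i2 := (memLp_two_of_four hp).integrable_sq
  have i3 := (hd.mul_four hp).integrable one_le_two
  have i4 := hd.integrable (by norm_num)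
  have i5 := hp.integrable (by norm_num)
  set b := psi4 F x - gini F with hb
  have hexp : ∀ y, ctrDist F x y ^ 2 = ((‖x - y‖ ^ 2 + psi4 F y ^ 2) -
      2 * (‖x - y‖ * psi4 F y)) + ((2 * b) * psi4 F y - (2 * b) * ‖x - y‖ + b ^ 2) := by
    intro y; rw [ctrDist, hb]; ring
  simp only [ctrDistSq, hexp]
  rw [integral_add, integral_sub, integral_add i1 i2, integral_add, integral_sub,
    integral_const_mul, integral_const_mul, integral_const_mul, integral_psi4 F h4,
    ← psi3_eq F h4, psi2_eq]
  · have e1 : ∫ y, ‖x - y‖ ^ 2 ∂F = psi1 F x := rfl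
    have e2 : ∫ y, ‖x - y‖ ∂F = psi4 F x := rfl
    rw [e1, e2]
    simp [hb]
    ring
  · exact i5.const_mul _
  · exact i4.const_mul _
  · exact (i5.const_mul _).sub (i4.const_mul _)
  · exact integrable_const _
  · exact i1.add i2
  · exact i3.const_mul _
  · exact (i1.add i2).sub (i3.const_mul _)
  · exact ((i5.const_mul _).sub (i4.const_mul _)).add (integrable_const _)

/-- The asymptotic variance is four times the variance of the projection. -/
lemma gammaVar_eq : gammaVar F = 4 * Var[ctrDistSq F; F] := by
  have hp := memLp_two_of_four (memLp_psi4_four F h4)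
  have hk : MemLp (fun x => psi1 F x - psi2 F x - 2 * psi3 F x) 2 F :=
    ((memLp_psi1 F h4).sub (memLp_psi2 F h4)).sub ((memLp_psi3 F h4).const_mul 2)
  have hEk : ∫ x, (psi1 F x - psi2 F x - 2 * psi3 F x) ∂F = popT1 F - 3 * popT3 F := by
    have j1 := (memLp_psi1 F h4).integrable one_le_two
    have j2 := (memLp_psi2 F h4).integrable one_le_two
    have j3 := (memLp_psi3 F h4).integrable one_le_two
    rw [integral_sub, integral_sub j1 j2, integral_const_mul,
      integral_psi1 F h4, integral_psi2 F h4, integral_psi3 F h4]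
    · ring
    · exact j1.sub j2
    · exact j3.const_mul 2
  set k := fun x => psi1 F x - psi2 F x - 2 * psi3 F x with hkdef
  have hf : MemLp (fun x => k x + 2 * gini F * psi4 F x) 2 F := hk.add (hp.const_mul _)
  -- The additive constant drops out of the variance. Since m₁₁, m₁₂, m₂₂ are four times the
  -- (co)variances of k and ψ₄, the variance of k + 2Δψ₄, times four, is γ.
  have e : ctrDistSq F = fun x => (k x + 2 * gini F * psi4 F x) +
      (∫ y, psi4 F y ^ 2 ∂F - gini F ^ 2) := funext (ctrDistSq_eq F h4)
  have i1 := hk.integrable_sq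
  have i2 := hp.integrable_sq
  have i3 : Integrable (fun x => psi4 F x * k x) F := hp.integrable_mul hk
  have hsq : ∫ x, (k x + 2 * gini F * psi4 F x) ^ 2 ∂F = ∫ x, k x ^ 2 ∂F +
      4 * gini F * ∫ x, psi4 F x * k x ∂F + 4 * gini F ^ 2 * ∫ x, psi4 F x ^ 2 ∂F := by
    have : ∀ x, (k x + 2 * gini F * psi4 F x) ^ 2 = k x ^ 2 + 4 * gini F * (psi4 F x * k x) +
        4 * gini F ^ 2 * psi4 F x ^ 2 := fun x => by ring
    simp_rw [this]
    rw [integral_add, integral_add i1 (i3.const_mul _), integral_const_mul, integral_const_mul]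
    · exact i1.add (i3.const_mul _)
    · exact i2.const_mul _
  have h1 : ∫ x, (k x + 2 * gini F * psi4 F x) ∂F =
      (popT1 F - 3 * popT3 F) + 2 * gini F * gini F := by
    rw [integral_add (hk.integrable one_le_two) ((hp.integrable one_le_two).const_mul _),
      integral_const_mul, hEk, integral_psi4 F h4]
  rw [e, variance_add_const hf.aestronglyMeasurable, variance_eq_sub hf]
  simp only [Pi.pow_apply]
  rw [hsq, h1, gammaVar, m11, m12, m22]
  ring

end Kernel

/-! ### Algebra of the sample distance variance -/

section SampleAlgebra

variable {ι : Type*} [Fintype ι] (A : ι → ι → ℝ) (u : ι → ℝ)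

lemma sum_sum_mul_eq_sum_sq (a : ι → ι → ℝ) :
    ∑ i, ∑ j, ∑ k, a i j * a i k = ∑ i, (∑ j, a i j) ^ 2 := by
  refine Finset.sum_congr rfl fun i _ => ?_
  rw [sq, Finset.sum_mul_sum]

/-- This and the next two lemmas record how adding uᵢ + uⱼ changes the three sums in 𝒱ₙ²; the
changes cancel in `sampleDistVar_eq`. -/
lemma sum_sum_add_add :
    ∑ i, ∑ j, (A i j + u i + u j) =
      ∑ i, ∑ j, A i j + 2 * (Fintype.card ι : ℝ) * ∑ i, u i := by
  simp only [Finset.sum_add_distrib, Finset.sum_const, Finset.card_univ, nsmul_eq_mul,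
    ← Finset.mul_sum]
  ring

lemma sum_sum_add_add_sq (hA : ∀ i j, A i j = A j i) :
    ∑ i, ∑ j, (A i j + u i + u j) ^ 2 =
      ∑ i, ∑ j, A i j ^ 2 + 4 * ∑ i, (∑ j, A i j) * u i +
        2 * (Fintype.card ι : ℝ) * ∑ i, u i ^ 2 + 2 * (∑ i, u i) ^ 2 := by
  have h1 : ∀ i j, (A i j + u i + u j) ^ 2 = A i j ^ 2 + 2 * (A i j * u i) + 2 * (A j i * u j) +
      u i ^ 2 + u j ^ 2 + 2 * (u i * u j) := fun i j => by rw [hA j i]; ring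
  have h2 : ∑ i, ∑ j, A i j * u i = ∑ i, (∑ j, A i j) * u i := by simp_rw [Finset.sum_mul]
  have h3 : ∑ i, ∑ j, A j i * u j = ∑ i, (∑ j, A i j) * u i := by rw [Finset.sum_comm, h2]
  have h5 : ∑ i, ∑ j, u i * u j = (∑ i, u i) ^ 2 := by rw [sq, Finset.sum_mul_sum]
  simp only [h1, Finset.sum_add_distrib, ← Finset.mul_sum, Finset.sum_const, Finset.card_univ,
    nsmul_eq_mul] at h2 h3 h5 ⊢
  rw [h2, h3, h5]
  ring

lemma sum_sq_sum_add_add :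
    ∑ i, (∑ j, (A i j + u i + u j)) ^ 2 =
      ∑ i, (∑ j, A i j) ^ 2 + (Fintype.card ι : ℝ) ^ 2 * ∑ i, u i ^ 2 +
        3 * (Fintype.card ι : ℝ) * (∑ i, u i) ^ 2 +
        2 * (Fintype.card ι : ℝ) * ∑ i, (∑ j, A i j) * u i +
        2 * (∑ i, ∑ j, A i j) * ∑ i, u i := by
  set U := ∑ i, u i with hU
  have h1 : ∀ i, (∑ j, (A i j + u i + u j)) ^ 2 = (∑ j, A i j) ^ 2 +
      (Fintype.card ι : ℝ) ^ 2 * u i ^ 2 + U ^ 2 +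
      2 * (Fintype.card ι : ℝ) * ((∑ j, A i j) * u i) + 2 * U * (∑ j, A i j) +
      2 * (Fintype.card ι : ℝ) * U * u i := by
    intro i
    simp only [Finset.sum_add_distrib, Finset.sum_const, Finset.card_univ, nsmul_eq_mul, ← hU]
    ring
  rw [Finset.sum_congr rfl fun i _ => h1 i]
  iterate 5 rw [Finset.sum_add_distrib]
  simp only [← Finset.mul_sum, Finset.sum_const, Finset.card_univ, nsmul_eq_mul]
  ring

end SampleAlgebra

/-! ### Centred and unbiased forms of the sample statistics -/

section Sample

variable {p n : ℕ} (F : Measure (EuclideanSpace ℝ (Fin p))) (x : Fin n → EuclideanSpace ℝ (Fin p))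

lemma sampleDistVar_eq (hn : n ≠ 0) :
    sampleDistVar x = 1 / (n : ℝ) ^ 2 * ∑ i, ∑ j, ctrDist F (x i) (x j) ^ 2 +
      (1 / (n : ℝ) ^ 2 * ∑ i, ∑ j, ctrDist F (x i) (x j)) ^ 2 -
      2 / (n : ℝ) ^ 3 * ∑ i, (∑ j, ctrDist F (x i) (x j)) ^ 2 := by
  -- Half of Δ is put in each uᵢ, so that uᵢ + uⱼ is exactly the distance minus its double centring.
  set u : Fin n → ℝ := fun i => psi4 F (x i) - gini F / 2 with hu
  have ha : ∀ i j, ‖x i - x j‖ = ctrDist F (x i) (x j) + u i + u j := fun i j => by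
    rw [ctrDist, hu]; ring
  have hn' : (n : ℝ) ≠ 0 := Nat.cast_ne_zero.2 hn
  rw [sampleDistVar, sampleT1, sampleT2, sampleT3,
    sum_sum_mul_eq_sum_sq fun i j => ‖x i - x j‖]
  simp_rw [ha]
  rw [sum_sum_add_add_sq (fun i j => ctrDist F (x i) (x j)) u (fun i j => ctrDist_comm F _ _),
    sum_sum_add_add, sum_sq_sum_add_add]
  simp only [Fintype.card_fin]
  field_simp
  ring

/-- Hoeffding decomposition of the squared kernel. The degenerate part is summed over the diagonal
as well, which makes the identity exact for every n ≥ 1. -/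
lemma sampleDistVar_sub_eq (hn : n ≠ 0) :
    sampleDistVar x - distVar F - 2 / (n : ℝ) * ∑ i, (ctrDistSq F (x i) - distVar F) =
      1 / (n : ℝ) ^ 2 * ∑ i, ∑ j, degDistSq F (x i) (x j) +
      (1 / (n : ℝ) ^ 2 * ∑ i, ∑ j, ctrDist F (x i) (x j)) ^ 2 -
      2 / (n : ℝ) ^ 3 * ∑ i, (∑ j, ctrDist F (x i) (x j)) ^ 2 := by
  have hn' : (n : ℝ) ≠ 0 := Nat.cast_ne_zero.2 hn
  have h1 : ∑ i, ∑ j, degDistSq F (x i) (x j) = ∑ i, ∑ j, ctrDist F (x i) (x j) ^ 2 -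
      2 * (n : ℝ) * ∑ i, ctrDistSq F (x i) + (n : ℝ) ^ 2 * distVar F := by
    simp only [degDistSq, Finset.sum_add_distrib, Finset.sum_sub_distrib, Finset.sum_const,
      Finset.card_univ, Fintype.card_fin, nsmul_eq_mul, ← Finset.mul_sum]
    ring
  rw [sampleDistVar_eq F x hn, h1, Finset.sum_sub_distrib]
  simp only [Finset.sum_const, Finset.card_univ, Fintype.card_fin, nsmul_eq_mul]
  field_simp
  ring

lemma hatGini_eq :
    hatGini x = 1 / ((n : ℝ) * ((n : ℝ) - 1)) * ∑ i, ∑ j, ‖x i - x j‖ := by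
  have h1 : ∑ i, ∑ j ∈ Finset.Ioi i, ‖x i - x j‖ = ∑ i, ∑ j, if i < j then ‖x i - x j‖ else 0 := by
    refine Finset.sum_congr rfl fun i _ => ?_
    rw [← Finset.sum_filter]
    congr 1
    ext j; simp
  have h2 : ∑ i, ∑ j, ‖x i - x j‖ = ∑ i, ∑ j, (if i < j then ‖x i - x j‖ else 0) +
      ∑ i, ∑ j, (if j < i then ‖x j - x i‖ else 0) := by
    rw [← Finset.sum_add_distrib]
    refine Finset.sum_congr rfl fun i _ => ?_
    rw [← Finset.sum_add_distrib]
    refine Finset.sum_congr rfl fun j _ => ?_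
    rcases lt_trichotomy i j with h | h | h
    · simp [h, h.le]
    · simp [h]
    · simp [h, h.le, norm_sub_rev]
  rw [Finset.sum_comm (f := fun i j => if j < i then ‖x j - x i‖ else 0)] at h2
  rw [hatGini, h2, h1]
  ring

/-- Removing the restriction to distinct indices costs nothing in total: i = j contributes 0, while
the corrections for k = j and k = i are ‖xᵢ-xⱼ‖² with opposite signs and cancel. -/
lemma hatW_eq :
    hatW x = 1 / ((n : ℝ) * ((n : ℝ) - 1) * ((n : ℝ) - 2)) *
      ((n : ℝ) * ∑ i, ∑ j, ‖x i - x j‖ ^ 2 - 2 * ∑ i, (∑ j, ‖x i - x j‖) ^ 2) := by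
  have h1 : ∀ i j k : Fin n, (if i ≠ j ∧ j ≠ k ∧ k ≠ i then
      ‖x i - x j‖ * (‖x i - x j‖ - 2 * ‖x i - x k‖) else 0) =
      (‖x i - x j‖ ^ 2 - 2 * (‖x i - x j‖ * ‖x i - x k‖)) +
      (if k = j then ‖x i - x j‖ ^ 2 else 0) - (if k = i then ‖x i - x j‖ ^ 2 else 0) := by
    intro i j k
    by_cases hij : i = j
    · subst hij; simp
    by_cases hjk : j = k
    · subst hjk
      simp [Ne.symm hij]; ring
    by_cases hki : k = i
    · subst hki; simp [Ne.symm hjk]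
    · simp [hij, hjk, hki, Ne.symm hjk]; ring
  rw [hatW]
  congr 1
  simp_rw [h1, ← sum_sum_mul_eq_sum_sq fun i j => ‖x i - x j‖, Finset.sum_sub_distrib,
    Finset.sum_add_distrib, Finset.sum_sub_distrib, Finset.sum_ite_eq', Finset.mem_univ, if_true,
    Finset.sum_const, Finset.card_univ, Fintype.card_fin, nsmul_eq_mul, ← Finset.mul_sum]
  ring

/-- Both statistics combine the same sums S, R, D² with slightly different normalisations, and
Cauchy–Schwarz bounds R by nS and D² by n²S. -/
lemma abs_hatDistVar_sub_le (hn : 3 ≤ n) :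
    |hatDistVar x - sampleDistVar x| ≤ 48 / (n : ℝ) ^ 3 * ∑ i, ∑ j, ‖x i - x j‖ ^ 2 := by
  set S := ∑ i, ∑ j, ‖x i - x j‖ ^ 2 with hS
  set D := ∑ i, ∑ j, ‖x i - x j‖ with hD
  set R := ∑ i, (∑ j, ‖x i - x j‖) ^ 2 with hR
  have hS0 : 0 ≤ S := Finset.sum_nonneg fun i _ => Finset.sum_nonneg fun j _ => sq_nonneg _
  have hR0 : 0 ≤ R := Finset.sum_nonneg fun i _ => sq_nonneg _
  have hRS : R ≤ n * S := by
    rw [hR, hS, Finset.mul_sum]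
    refine Finset.sum_le_sum fun i _ => ?_
    simpa using sq_sum_le_card_mul_sum_sq (s := Finset.univ) (f := fun j => ‖x i - x j‖)
  have hDR : D ^ 2 ≤ n * R := by
    simpa using sq_sum_le_card_mul_sum_sq (s := Finset.univ) (f := fun i => ∑ j, ‖x i - x j‖)
  have hN : (3 : ℝ) ≤ n := by exact_mod_cast hn
  obtain ⟨N, hNdef⟩ : ∃ N : ℝ, N = n := ⟨_, rfl⟩
  rw [← hNdef] at hRS hDR hN ⊢
  have hDS : D ^ 2 ≤ N ^ 2 * S := by nlinarith
  -- Here c = 1/(N(N-1)(N-2)) - 1/N³ and d = 1/(N(N-1))² - 1/N⁴ are the differences of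
  -- normalisations. The three terms are at most 1, 2 and 1 times NcS, and Nc ≤ 12/N³ for N ≥ 3,
  -- hence 48.
  set c := (3 * N - 2) / (N ^ 3 * (N - 1) * (N - 2)) with hc
  set d := (2 * N - 1) / (N ^ 4 * (N - 1) ^ 2) with hd
  have hN0 : 0 < N := by linarith
  have hN1 : 0 < N - 1 := by linarith
  have hN2 : 0 < N - 2 := by linarith
  have hc0 : 0 ≤ c := div_nonneg (by linarith) (by positivity)
  have hd0 : 0 ≤ d := div_nonneg (by linarith) (by positivity)
  have hdiff : hatDistVar x - sampleDistVar x = N * c * S - 2 * c * R + d * D ^ 2 := by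
    rw [hatDistVar, hatW_eq, hatGini_eq, sampleDistVar, sampleT1, sampleT2, sampleT3,
      sum_sum_mul_eq_sum_sq fun i j => ‖x i - x j‖, ← hS, ← hD, ← hR, ← hNdef, hc, hd]
    field_simp
    ring
  have hdc : N ^ 2 * d ≤ N * c := by
    rw [hc, hd, mul_div_assoc', mul_div_assoc', div_le_div_iff₀ (by positivity) (by positivity)]
    have : (2 * N - 1) * (N - 2) ≤ (3 * N - 2) * (N - 1) := by nlinarith
    have h5 : 0 ≤ N ^ 5 * (N - 1) := by positivity
    nlinarith [mul_le_mul_of_nonneg_left this h5]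
  have hcb : N * c ≤ 12 / N ^ 3 := by
    rw [hc, mul_div_assoc', div_le_div_iff₀ (by positivity) (by positivity)]
    have : N * (3 * N - 2) ≤ 12 * ((N - 1) * (N - 2)) := by nlinarith
    have h5 : 0 ≤ N ^ 3 := by positivity
    nlinarith [mul_le_mul_of_nonneg_left this h5]
  have b1 : 2 * c * R ≤ 2 * (N * c * S) := by nlinarith [mul_le_mul_of_nonneg_left hRS hc0]
  have b2 : d * D ^ 2 ≤ N * c * S := by
    nlinarith [mul_le_mul_of_nonneg_left hDS hd0, mul_le_mul_of_nonneg_right hdc hS0]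
  have b3 : N * c * S ≤ 12 / N ^ 3 * S := mul_le_mul_of_nonneg_right hcb hS0
  have b4 : 0 ≤ 2 * c * R := by positivity
  have b5 : 0 ≤ d * D ^ 2 := by positivity
  have b6 : 48 / N ^ 3 * S = 4 * (12 / N ^ 3 * S) := by ring
  have b7 : 0 ≤ N * c * S := by positivity
  rw [hdiff, abs_le, b6]
  constructor <;> linarith

end Sample
open scoped Topology

/-! ### Limit theorems for statistics with a linear leading term -/

section Limit

variable {Ω : Type*} [MeasurableSpace Ω] {P : Measure Ω} [IsProbabilityMeasure P]

/-- Markov's inequality applied to the dominating variable. -/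
lemma tendstoInMeasure_zero_of_abs_le {R B : ℕ → Ω → ℝ} {b : ℕ → ℝ} (hB : ∀ n, Integrable (B n) P)
    (hRB : ∀ᶠ n in atTop, ∀ ω, |R n ω| ≤ B n ω) (hBb : ∀ᶠ n in atTop, ∫ ω, B n ω ∂P ≤ b n)
    (hb : Tendsto b atTop (𝓝 0)) : TendstoInMeasure P R atTop 0 := by
  rw [tendstoInMeasure_iff_measureReal_norm]
  intro ε hε
  have hb' : Tendsto (fun n => b n / ε) atTop (𝓝 0) := by simpa using hb.div_const ε
  refine squeeze_zero' (Eventually.of_forall fun n => measureReal_nonneg) ?_ hb'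
  filter_upwards [hRB, hBb] with n h1 h2
  have h3 : P.real {ω | ε ≤ ‖R n ω - (0 : Ω → ℝ) ω‖} ≤ P.real {ω | ε ≤ B n ω} := by
    refine measureReal_mono fun ω hω => ?_
    simp only [Set.mem_ofPred_eq, Pi.zero_apply, sub_zero, Real.norm_eq_abs] at hω ⊢
    exact hω.trans (h1 ω)
  have h4 := mul_meas_ge_le_integral_of_nonneg
    (Eventually.of_forall fun ω => (abs_nonneg _).trans (h1 ω)) (hB n) ε
  rw [le_div_iff₀ hε, mul_comm]
  calc ε * P.real {ω | ε ≤ ‖R n ω - (0 : Ω → ℝ) ω‖} ≤ ε * P.real {ω | ε ≤ B n ω} := by gcongr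
    _ ≤ _ := h4.trans h2

lemma TendstoInDistribution.of_map_eq {Ω₁ Ω₂ : Type*} [MeasurableSpace Ω₁] [MeasurableSpace Ω₂]
    {μ₁ : Measure Ω₁} {μ₂ : Measure Ω₂} [IsProbabilityMeasure μ₁] [IsProbabilityMeasure μ₂]
    {X : ℕ → Ω → ℝ} {Z : Ω₁ → ℝ} {W : Ω₂ → ℝ}
    (h : TendstoInDistribution X atTop Z (fun _ => P) μ₁) (hW : AEMeasurable W μ₂)
    (hZW : μ₁.map Z = μ₂.map W) : TendstoInDistribution X atTop W (fun _ => P) μ₂ where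
  forall_aemeasurable := h.forall_aemeasurable
  aemeasurable_limit := hW
  tendsto := by
    have := h.tendsto
    convert this using 3
    exact congrArg _ (Subtype.ext hZW.symm)

variable {Y T B : ℕ → Ω → ℝ} {θ K : ℝ}

/-- A statistic that differs from a constant plus an empirical mean by a remainder of order `1 / n`
in `L¹` is asymptotically normal. -/
lemma tendstoInDistribution_of_remainder (hY : MemLp (Y 0) 2 P) (hindep : iIndepFun Y P)
    (hident : ∀ i, IdentDistrib (Y i) (Y 0) P P) (hT : ∀ n, AEMeasurable (T n) P)
    (hB : ∀ n, Integrable (B n) P)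
    (hTB : ∀ᶠ n : ℕ in atTop, ∀ ω,
      |T n ω - θ - 1 / (n : ℝ) * (∑ k ∈ Finset.range n, Y k ω - n * P[Y 0])| ≤ B n ω)
    (hBK : ∀ᶠ n : ℕ in atTop, ∫ ω, B n ω ∂P ≤ K / n) :
    TendstoInDistribution (fun (n : ℕ) ω => √n * (T n ω - θ)) atTop id (fun _ => P)
      (gaussianReal 0 Var[Y 0; P].toNNReal) := by
  have hclt := tendstoInDistribution_inv_sqrt_mul_sum_sub
    (HasLaw.id (μ := gaussianReal 0 Var[Y 0; P].toNNReal)) hY hindep hident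
  -- Slutsky: √n times the remainder has L¹ norm at most √n · K/n, which tends to 0.
  refine tendstoInDistribution_of_tendstoInMeasure_sub _ _ hclt ?_ fun n =>
    ((hT n).sub_const _).const_mul _
  refine tendstoInMeasure_zero_of_abs_le (B := fun n ω => √n * B n ω) (b := fun n => K * (√n)⁻¹)
    (fun n => (hB n).const_mul _) ?_ ?_ ?_
  · filter_upwards [hTB, eventually_gt_atTop 0] with n h1 hn ω
    have hn' : (0 : ℝ) < n := by exact_mod_cast hn
    have hs : 0 < √(n : ℝ) := Real.sqrt_pos.2 hn'
    have e : (√(n : ℝ))⁻¹ = √n * (1 / n) := by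
      have := Real.mul_self_sqrt hn'.le
      field_simp
      nlinarith
    simp only [Pi.sub_apply]
    rw [e, mul_assoc, ← mul_sub, abs_mul, abs_of_pos hs]
    exact mul_le_mul_of_nonneg_left (h1 ω) hs.le
  · filter_upwards [hBK, eventually_gt_atTop 0] with n h1 hn
    have hn' : (0 : ℝ) < n := by exact_mod_cast hn
    have hs : 0 < √(n : ℝ) := Real.sqrt_pos.2 hn'
    rw [integral_const_mul]
    refine (mul_le_mul_of_nonneg_left h1 hs.le).trans (le_of_eq ?_)
    have := Real.sq_sqrt hn'.le
    field_simp
    rw [this, mul_comm]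
  · have h1 : Tendsto (fun n : ℕ => √(n : ℝ)) atTop atTop :=
      Real.tendsto_sqrt_atTop.comp tendsto_natCast_atTop_atTop
    simpa using h1.inv_tendsto_atTop.const_mul K

/-- Consistency, needed for the delta method: the law of large numbers handles the empirical mean
and Markov the remainder. -/
lemma tendstoInMeasure_of_remainder (hY : Integrable (Y 0) P) (hindep : iIndepFun Y P)
    (hident : ∀ i, IdentDistrib (Y i) (Y 0) P P) (hB : ∀ n, Integrable (B n) P)
    (hTB : ∀ᶠ n : ℕ in atTop, ∀ ω,
      |T n ω - θ - 1 / (n : ℝ) * (∑ k ∈ Finset.range n, Y k ω - n * P[Y 0])| ≤ B n ω)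
    (hBK : ∀ᶠ n : ℕ in atTop, ∫ ω, B n ω ∂P ≤ K / n) :
    TendstoInMeasure P T atTop fun _ => θ := by
  have hYm : ∀ i, AEMeasurable (Y i) P := fun i => (hident i).aemeasurable_fst
  have hlln := strong_law_ae_real Y hY (fun i j hij => hindep.indepFun hij) hident
  have hR := tendstoInMeasure_zero_of_abs_le hB hTB hBK
    (tendsto_const_div_atTop_nhds_zero_nat K)
  have hL : TendstoInMeasure P
      (fun (n : ℕ) ω => 1 / (n : ℝ) * (∑ k ∈ Finset.range n, Y k ω - n * P[Y 0])) atTop 0 := by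
    refine tendstoInMeasure_of_tendsto_ae (fun n => ?_) ?_
    · exact ((((Finset.aemeasurable_fun_sum _ fun i _ => hYm i).sub_const _).const_mul
        _)).aestronglyMeasurable
    · filter_upwards [hlln] with ω hω
      have h1 := hω.sub_const (P[Y 0])
      rw [sub_self] at h1
      refine h1.congr' ?_
      filter_upwards [eventually_gt_atTop 0] with n hn
      have hn' : (n : ℝ) ≠ 0 := Nat.cast_ne_zero.2 hn.ne'
      field_simp
  rw [tendstoInMeasure_iff_measureReal_norm] at hR hL ⊢
  intro ε hε
  have hsum := (hR (ε / 2) (half_pos hε)).add (hL (ε / 2) (half_pos hε))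
  rw [add_zero] at hsum
  refine squeeze_zero (fun n => measureReal_nonneg) (fun n => ?_) hsum
  refine le_trans (measureReal_mono fun ω hω => ?_) (measureReal_union_le _ _)
  simp only [Set.mem_union, Set.mem_ofPred_eq, Pi.zero_apply, sub_zero, Real.norm_eq_abs] at hω ⊢
  by_contra! hcon
  have := abs_add_le
    (T n ω - θ - 1 / (n : ℝ) * (∑ k ∈ Finset.range n, Y k ω - n * P[Y 0]))
    (1 / (n : ℝ) * (∑ k ∈ Finset.range n, Y k ω - n * P[Y 0]))
  rw [sub_add_cancel] at this
  linarith [hcon.1, hcon.2]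

/-- The delta method for the square root at a positive point. -/
lemma tendstoInDistribution_sqrt {v : ℝ} (hv : 0 ≤ v) (hθ : 0 < θ)
    (hT : ∀ n, AEMeasurable (T n) P) (hprob : TendstoInMeasure P T atTop fun _ => θ)
    (hdist : TendstoInDistribution (fun (n : ℕ) ω => √n * (T n ω - θ)) atTop id (fun _ => P)
      (gaussianReal 0 v.toNNReal)) :
    TendstoInDistribution (fun (n : ℕ) ω => √n * (√(T n ω) - √θ)) atTop id (fun _ => P)
      (gaussianReal 0 (v / (4 * θ)).toNNReal) := by
  -- The difference quotient, filled in at θ by the derivative, is continuous on all of ℝ, because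
  -- `Real.sqrt` is continuous there (being 0 on negatives) and differentiable at θ > 0. The
  -- factorisation √T - √θ = dslope(T)(T - θ) is therefore exact even where the statistic is
  -- negative.
  have hc : Continuous (dslope Real.sqrt θ) := by
    rw [← continuousOn_univ, continuousOn_dslope univ_mem]
    exact ⟨Real.continuous_sqrt.continuousOn, (Real.hasDerivAt_sqrt hθ.ne').differentiableAt⟩
  have h1 := hdist.continuous_comp_prodMk_of_tendstoInMeasure_const
    (g := fun w : ℝ × ℝ => dslope Real.sqrt θ w.2 * w.1) (by fun_prop) hprob hT
  have h2 : (fun (n : ℕ) ω => √n * (√(T n ω) - √θ)) =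
      fun (n : ℕ) ω => dslope Real.sqrt θ (T n ω) * (√n * (T n ω - θ)) := by
    ext n ω
    have := sub_smul_dslope Real.sqrt θ (T n ω)
    rw [smul_eq_mul] at this
    rw [← this]; ring
  rw [h2]
  refine TendstoInDistribution.of_map_eq h1 aemeasurable_id ?_
  simp only [id, dslope_same, (Real.hasDerivAt_sqrt hθ.ne').deriv]
  rw [gaussianReal_map_const_mul, Measure.map_id, mul_zero]
  congr 1
  ext
  rw [NNReal.coe_mul, Real.coe_toNNReal _ hv, Real.coe_toNNReal _ (by positivity), NNReal.coe_mk,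
    div_pow, mul_pow, Real.sq_sqrt hθ.le]
  ring

end Limit
/-! ### Asymptotic normality of the sample distance variance -/

section Main

variable {p : ℕ} {Ω : Type*} [MeasurableSpace Ω] {P : Measure Ω} [IsProbabilityMeasure P]
  {F : Measure (EuclideanSpace ℝ (Fin p))} [IsProbabilityMeasure F]
  {X : ℕ → Ω → EuclideanSpace ℝ (Fin p)}

lemma measurable_sampleDistVar (n : ℕ) :
    Measurable (sampleDistVar : (Fin n → EuclideanSpace ℝ (Fin p)) → ℝ) := by
  unfold sampleDistVar sampleT1 sampleT2 sampleT3
  fun_prop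

lemma measurable_hatDistVar (n : ℕ) :
    Measurable (hatDistVar : (Fin n → EuclideanSpace ℝ (Fin p)) → ℝ) := by
  unfold hatDistVar
  simp_rw [funext hatW_eq, funext hatGini_eq]
  fun_prop

/-- A bound for the remainder of the linear expansion of the sample distance variance. -/
noncomputable def remainderBound (F : Measure (EuclideanSpace ℝ (Fin p))) {n : ℕ}
    (x : Fin n → EuclideanSpace ℝ (Fin p)) : ℝ :=
  ((n : ℝ) * (1 / (n : ℝ) ^ 2 * ∑ i, ∑ j, degDistSq F (x i) (x j)) ^ 2 + 1 / n) / 2 +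
    (1 / (n : ℝ) ^ 2 * ∑ i, ∑ j, ctrDist F (x i) (x j)) ^ 2 +
    2 / (n : ℝ) ^ 3 * ∑ i, (∑ j, ctrDist F (x i) (x j)) ^ 2

lemma abs_sampleDistVar_sub_le (F : Measure (EuclideanSpace ℝ (Fin p))) {n : ℕ} (hn : n ≠ 0)
    (x : Fin n → EuclideanSpace ℝ (Fin p)) :
    |sampleDistVar x - distVar F - 2 / (n : ℝ) * ∑ i, (ctrDistSq F (x i) - distVar F)| ≤
      remainderBound F x := by
  have hn' : (0 : ℝ) < n := by exact_mod_cast Nat.pos_of_ne_zero hn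
  rw [sampleDistVar_sub_eq F x hn, remainderBound]
  set r := 1 / (n : ℝ) ^ 2 * ∑ i, ∑ j, degDistSq F (x i) (x j)
  set q := (1 / (n : ℝ) ^ 2 * ∑ i, ∑ j, ctrDist F (x i) (x j)) ^ 2
  have hq : 0 ≤ q := sq_nonneg _
  have ht : 0 ≤ 2 / (n : ℝ) ^ 3 * ∑ i, (∑ j, ctrDist F (x i) (x j)) ^ 2 :=
    mul_nonneg (by positivity) (Finset.sum_nonneg fun i _ => sq_nonneg _)
  set t := 2 / (n : ℝ) ^ 3 * ∑ i, (∑ j, ctrDist F (x i) (x j)) ^ 2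
  -- The weights n and 1/n balance: E r² = O(n⁻²), so both parts are O(1/n) in mean.
  have hr : |r| ≤ ((n : ℝ) * r ^ 2 + 1 / n) / 2 := by
    have h1 : (n : ℝ) * r ^ 2 + 1 / n - 2 * |r| = (n * |r| - 1) ^ 2 / n := by
      rw [← sq_abs r]; field_simp; ring
    have h2 : 0 ≤ (n * |r| - 1) ^ 2 / (n : ℝ) := by positivity
    linarith
  have := abs_le.1 hr
  rw [abs_le]
  constructor <;> linarith [this.1, this.2]

variable (hlaw : ∀ i, HasLaw (X i) F P) (hindep : iIndepFun X P)
  (h4 : MemLp (fun x : EuclideanSpace ℝ (Fin p) => ‖x‖) 4 F)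
include hlaw hindep h4

lemma memLp_sum_ctrDist {ι : Type*} [Fintype ι] (f : ι → ℕ) (i : ι) :
    MemLp (fun ω => ∑ j, ctrDist F (X (f i) ω) (X (f j) ω)) 2 P :=
  memLp_finsetSum _ fun _ _ => memLp_comp_pair (h := ctrDist F) hlaw hindep
    (memLp_two_of_four (memLp_ctrDist F h4)) (memLp_two_of_four (memLp_ctrDist_diag F h4)) _ _

lemma exists_remainderBound : ∃ K, ∀ n : ℕ, n ≠ 0 →
    Integrable (fun ω => remainderBound F fun i : Fin n => X i ω) P ∧
      ∫ ω, remainderBound F (fun i : Fin n => X i ω) ∂P ≤ K / n := by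
  set CA := ∫ w, ctrDist F w.1 w.2 ^ 2 ∂(F.prod F) + ∫ x, ctrDist F x x ^ 2 ∂F with hCA
  set CH := ∫ w, degDistSq F w.1 w.2 ^ 2 ∂(F.prod F) + ∫ x, degDistSq F x x ^ 2 ∂F with hCH
  -- The summands come from the degenerate sum with its 1/n term, the squared mean of a (in fact
  -- O(n⁻²), bounded crudely), and the row sums.
  refine ⟨(3 * CH + 1) / 2 + 3 * CA + 2 * CA, fun n hn => ?_⟩
  have hn' : (0 : ℝ) < n := by exact_mod_cast Nat.pos_of_ne_zero hn
  have hn1 : (1 : ℝ) ≤ n := by exact_mod_cast Nat.one_le_iff_ne_zero.2 hn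
  have hlaw' : ∀ i : Fin n, HasLaw (X i) F P := fun i => hlaw i
  have hindep' : iIndepFun (fun i : Fin n => X i) P := hindep.precomp Fin.val_injective
  have hAm : Measurable (Function.uncurry (ctrDist F)) := (continuous_ctrDist F h4).measurable
  have hA2 : MemLp (Function.uncurry (ctrDist F)) 2 (F.prod F) :=
    memLp_two_of_four (memLp_ctrDist F h4)
  have hAd := memLp_two_of_four (memLp_ctrDist_diag F h4)
  have b1 := integral_sq_sum_sum_le hlaw' hindep' (measurable_degDistSq F h4) (memLp_degDistSq F h4)
    (memLp_degDistSq_diag F h4) (degDistSq_comm F) (integral_degDistSq F h4)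
  have b2 := integral_sq_sum_sum_le hlaw' hindep' hAm hA2 hAd (ctrDist_comm F)
    (integral_ctrDist F h4)
  have b3 := integral_sq_sum_le hlaw' hindep' hAm hA2 hAd (ctrDist_comm F) (integral_ctrDist F h4)
  rw [Fintype.card_fin, ← hCH] at b1
  rw [Fintype.card_fin, ← hCA] at b2
  simp only [Fintype.card_fin, ← hCA] at b3
  have hCA0 : 0 ≤ CA := add_nonneg (integral_nonneg fun _ => sq_nonneg _)
    (integral_nonneg fun _ => sq_nonneg _)
  have i1 : Integrable (fun ω => (∑ i : Fin n, ∑ j : Fin n, degDistSq F (X i ω) (X j ω)) ^ 2) P :=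
    (memLp_finsetSum _ fun i _ => memLp_finsetSum _ fun j _ => memLp_comp_pair hlaw' hindep'
      (memLp_degDistSq F h4) (memLp_degDistSq_diag F h4) i j).integrable_sq
  have i2 : Integrable (fun ω => (∑ i : Fin n, ∑ j : Fin n, ctrDist F (X i ω) (X j ω)) ^ 2) P :=
    (memLp_finsetSum _ fun i _ => memLp_sum_ctrDist hlaw hindep h4 Fin.val i).integrable_sq
  have i3 : ∀ i : Fin n, Integrable (fun ω => (∑ j : Fin n, ctrDist F (X i ω) (X j ω)) ^ 2) P :=
    fun i => (memLp_sum_ctrDist hlaw hindep h4 Fin.val i).integrable_sq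
  have b4 : ∫ ω, ∑ i : Fin n, (∑ j : Fin n, ctrDist F (X i ω) (X j ω)) ^ 2 ∂P ≤
      CA * (n : ℝ) ^ 2 := by
    rw [integral_finsetSum _ fun i _ => i3 i]
    refine (Finset.sum_le_sum fun i _ => b3 i).trans (le_of_eq ?_)
    simp
    ring
  have i4 := integrable_finsetSum Finset.univ fun i _ => i3 i
  have hexp : (fun ω => remainderBound F fun i : Fin n => X i ω) = fun ω =>
      1 / (2 * (n : ℝ) ^ 3) * (∑ i : Fin n, ∑ j : Fin n, degDistSq F (X i ω) (X j ω)) ^ 2 +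
      1 / (n : ℝ) ^ 4 * (∑ i : Fin n, ∑ j : Fin n, ctrDist F (X i ω) (X j ω)) ^ 2 +
      2 / (n : ℝ) ^ 3 * ∑ i : Fin n, (∑ j : Fin n, ctrDist F (X i ω) (X j ω)) ^ 2 +
      1 / (2 * (n : ℝ)) := by
    ext ω
    rw [remainderBound]
    field_simp
    ring
  have j1 := i1.const_mul (1 / (2 * (n : ℝ) ^ 3))
  have j2 := i2.const_mul (1 / (n : ℝ) ^ 4)
  have j3 := i4.const_mul (2 / (n : ℝ) ^ 3)
  have j4 : Integrable (fun _ : Ω => 1 / (2 * (n : ℝ))) P := integrable_const _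
  rw [hexp]
  refine ⟨((j1.add j2).add j3).add j4, ?_⟩
  have hsum := integral_add ((j1.add j2).add j3) j4
  rw [integral_add' (j1.add j2) j3, integral_add' j1 j2, integral_const_mul, integral_const_mul,
    integral_const_mul] at hsum
  refine hsum.le.trans ?_
  have k1 := mul_le_mul_of_nonneg_left b1 (show 0 ≤ 1 / (2 * (n : ℝ) ^ 3) by positivity)
  have k2 := mul_le_mul_of_nonneg_left b2 (show 0 ≤ 1 / (n : ℝ) ^ 4 by positivity)
  have k3 := mul_le_mul_of_nonneg_left b4 (show 0 ≤ 2 / (n : ℝ) ^ 3 by positivity)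
  have e1 : 1 / (2 * (n : ℝ) ^ 3) * (3 * CH * (n : ℝ) ^ 2) = 3 * CH / 2 / n := by field_simp
  have e2 : 1 / (n : ℝ) ^ 4 * (3 * CA * (n : ℝ) ^ 2) ≤ 3 * CA / n := by
    rw [div_mul_eq_mul_div, one_mul, div_le_div_iff₀ (by positivity) hn']
    have : (n : ℝ) ^ 3 ≤ (n : ℝ) ^ 4 := pow_le_pow_right₀ hn1 (by norm_num)
    nlinarith
  have e3 : 2 / (n : ℝ) ^ 3 * (CA * (n : ℝ) ^ 2) = 2 * CA / n := by field_simp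
  have e4 : ((3 * CH + 1) / 2 + 3 * CA + 2 * CA) / (n : ℝ) =
      3 * CH / 2 / n + 3 * CA / n + 2 * CA / n + 1 / (2 * n) := by field_simp; ring
  have e5 : ∫ _ : Ω, 1 / (2 * (n : ℝ)) ∂P = 1 / (2 * n) := by simp
  rw [e4, e5]
  linarith

lemma integral_sum_norm_sub_sq_le (n : ℕ) :
    Integrable (fun ω => ∑ i : Fin n, ∑ j : Fin n, ‖X i ω - X j ω‖ ^ 2) P ∧
      ∫ ω, ∑ i : Fin n, ∑ j : Fin n, ‖X i ω - X j ω‖ ^ 2 ∂P ≤ popT1 F * (n : ℝ) ^ 2 := by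
  have hm : Measurable (Function.uncurry fun x y : EuclideanSpace ℝ (Fin p) => ‖x - y‖) := by
    unfold Function.uncurry; fun_prop
  have hL : ∀ i j : ℕ, MemLp (fun ω => ‖X i ω - X j ω‖) 2 P := fun i j =>
    memLp_comp_pair (h := fun x y => ‖x - y‖) hlaw hindep
      (memLp_two_of_four (memLp_norm_sub_prod F h4)) (by simp) i j
  have hB : ∀ i j : ℕ, ∫ ω, ‖X i ω - X j ω‖ ^ 2 ∂P ≤ popT1 F := fun i j => by
    simpa [popT1] using integral_sq_comp_pair_le hlaw hindep hm i j
  refine ⟨integrable_finsetSum _ fun i _ => integrable_finsetSum _ fun j _ =>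
    (hL i j).integrable_sq, ?_⟩
  rw [integral_finsetSum _ fun (i : Fin n) _ => integrable_finsetSum _ fun (j : Fin n) _ =>
    (hL i j).integrable_sq]
  simp_rw [fun i : Fin n => integral_finsetSum (μ := P) Finset.univ
    fun (j : Fin n) _ => (hL i j).integrable_sq]
  refine (Finset.sum_le_sum fun (i : Fin n) _ =>
    Finset.sum_le_sum fun (j : Fin n) _ => hB i j).trans (le_of_eq ?_)
  simp
  ring

/-- Both limit theorems for a statistic approximating the linear expansion of the sample distance
variance. -/
lemma tendstoInDistribution_of_distVar_remainder {T B : ℕ → Ω → ℝ} {K : ℝ}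
    (hT : ∀ n, AEMeasurable (T n) P) (hB : ∀ n, Integrable (B n) P)
    (hTB : ∀ᶠ n : ℕ in atTop, ∀ ω, |T n ω - distVar F -
      2 / (n : ℝ) * ∑ i : Fin n, (ctrDistSq F (X i ω) - distVar F)| ≤ B n ω)
    (hBK : ∀ᶠ n : ℕ in atTop, ∫ ω, B n ω ∂P ≤ K / n) :
    TendstoInDistribution (fun (n : ℕ) ω => √n * (T n ω - distVar F)) atTop id (fun _ => P)
      (gaussianReal 0 (gammaVar F).toNNReal) ∧
    (distSD F ≠ 0 → TendstoInDistribution (fun (n : ℕ) ω => √n * (√(T n ω) - distSD F)) atTop id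
      (fun _ => P) (gaussianReal 0 (gammaVar F / (4 * distSD F ^ 2)).toNNReal)) := by
  have hgm : Measurable fun x => 2 * ctrDistSq F x := (measurable_ctrDistSq F h4).const_mul 2
  have hgL : MemLp (fun x => 2 * ctrDistSq F x) 2 F := (memLp_ctrDistSq F h4).const_mul 2
  -- The factor 2, one for each argument of the kernel, is absorbed into the summand, so the
  -- variance of Y is γ itself.
  set Y : ℕ → Ω → ℝ := fun k ω => 2 * ctrDistSq F (X k ω) with hYdef
  have hY : MemLp (Y 0) 2 P := by
    have : MemLp (fun x => 2 * ctrDistSq F x) 2 (P.map (X 0)) := by rwa [(hlaw 0).map_eq]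
    exact this.comp_of_map (hlaw 0).aemeasurable
  have hYindep : iIndepFun Y P := hindep.comp (fun _ x => 2 * ctrDistSq F x) fun _ => hgm
  have hYident : ∀ i, IdentDistrib (Y i) (Y 0) P P := fun i =>
    IdentDistrib.comp (u := fun x => 2 * ctrDistSq F x)
      ⟨(hlaw i).aemeasurable, (hlaw 0).aemeasurable, by rw [(hlaw i).map_eq, (hlaw 0).map_eq]⟩ hgm
  have hYE : P[Y 0] = 2 * distVar F := by
    have := (hlaw 0).integral_comp hgm.aestronglyMeasurable
    simp only [Function.comp_def] at this
    rw [this, integral_const_mul, ← distVar_eq F h4]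
  have hYV : Var[Y 0; P] = gammaVar F := by
    have h1 : Var[Y 0; P] = Var[fun x => 2 * ctrDistSq F x; F] := by
      have h := variance_map (μ := P) hgm.aemeasurable (hlaw 0).aemeasurable
      rw [(hlaw 0).map_eq] at h
      exact h.symm
    rw [h1, variance_const_mul, gammaVar_eq F h4]
    norm_num
  have hTB' : ∀ᶠ n : ℕ in atTop, ∀ ω, |T n ω - distVar F -
      1 / (n : ℝ) * (∑ k ∈ Finset.range n, Y k ω - n * P[Y 0])| ≤ B n ω := by
    filter_upwards [hTB] with n hn ω
    convert hn ω using 3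
    rw [hYE, ← Fin.sum_univ_eq_sum_range (fun k => Y k ω) n, Finset.sum_sub_distrib]
    simp only [hYdef, Finset.sum_const, Finset.card_univ, Fintype.card_fin, nsmul_eq_mul,
      ← Finset.mul_sum]
    ring
  have hlim := tendstoInDistribution_of_remainder hY hYindep hYident hT hB hTB' hBK
  rw [hYV] at hlim
  refine ⟨hlim, fun hSD => ?_⟩
  have hγ : 0 ≤ gammaVar F := hYV ▸ variance_nonneg _ _
  have hθ : 0 < distVar F := Real.sqrt_ne_zero'.1 hSD
  have hprob := tendstoInMeasure_of_remainder (hY.integrable one_le_two) hYindep hYident hB hTB' hBK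
  rw [distSD, Real.sq_sqrt hθ.le]
  exact tendstoInDistribution_sqrt hγ hθ hT hprob hlim

end Main

theorem mainTheorem5 {p : ℕ} {Ω : Type*} [MeasurableSpace Ω]
    (P : Measure Ω) [IsProbabilityMeasure P]
    (F : Measure (EuclideanSpace ℝ (Fin p))) [IsProbabilityMeasure F]
    (X : ℕ → Ω → EuclideanSpace ℝ (Fin p))
    (hlaw : ∀ i, HasLaw (X i) F P) (hindep : iIndepFun X P)
    (hmoment : Integrable (fun x => ‖x‖ ^ 4) F) :
    0 ≤ gammaVar F ∧
    TendstoInDistribution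
      (fun (n : ℕ) (ω : Ω) =>
        Real.sqrt n * (sampleDistVar (fun i : Fin n => X i ω) - distVar F))
      atTop id (fun _ => P) (gaussianReal 0 (gammaVar F).toNNReal) ∧
    TendstoInDistribution
      (fun (n : ℕ) (ω : Ω) =>
        Real.sqrt n * (hatDistVar (fun i : Fin n => X i ω) - distVar F))
      atTop id (fun _ => P) (gaussianReal 0 (gammaVar F).toNNReal) ∧
    (distSD F ≠ 0 →
      TendstoInDistribution
        (fun (n : ℕ) (ω : Ω) =>
          Real.sqrt n * (sampleDistSD (fun i : Fin n => X i ω) - distSD F))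
        atTop id (fun _ => P)
        (gaussianReal 0 (gammaVar F / (4 * distSD F ^ 2)).toNNReal) ∧
      TendstoInDistribution
        (fun (n : ℕ) (ω : Ω) =>
          Real.sqrt n * (hatDistSD (fun i : Fin n => X i ω) - distSD F))
        atTop id (fun _ => P)
        (gaussianReal 0 (gammaVar F / (4 * distSD F ^ 2)).toNNReal)) := by
  have h4 : MemLp (fun x : EuclideanSpace ℝ (Fin p) => ‖x‖) 4 F := by
    rw [← integrable_norm_rpow_iff (by fun_prop) (by norm_num) (by norm_num)]
    refine hmoment.congr (Eventually.of_forall fun x => ?_)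
    simp only [norm_norm]
    norm_cast
  have hγ : 0 ≤ gammaVar F := by
    rw [gammaVar_eq F h4]
    have := variance_nonneg (ctrDistSq F) F
    positivity
  obtain ⟨K, hK⟩ := exists_remainderBound hlaw hindep h4
  have hS := integral_sum_norm_sub_sq_le hlaw hindep h4
  have hB0 : ∀ n : ℕ, Integrable (fun ω => remainderBound F fun i : Fin n => X i ω) P := by
    intro n
    rcases eq_or_ne n 0 with rfl | hn
    · simp [remainderBound]
    · exact (hK n hn).1
  have hX : ∀ n : ℕ, AEMeasurable (fun ω (i : Fin n) => X i ω) P := fun n =>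
    aemeasurable_pi_lambda _ fun i => (hlaw i).aemeasurable
  have hne : ∀ᶠ n : ℕ in atTop, n ≠ 0 := eventually_ne_atTop 0
  have hV := tendstoInDistribution_of_distVar_remainder hlaw hindep h4
    (T := fun n ω => sampleDistVar fun i : Fin n => X i ω)
    (B := fun n ω => remainderBound F fun i : Fin n => X i ω) (K := K)
    (fun n => (measurable_sampleDistVar n).comp_aemeasurable (hX n)) hB0
    (hne.mono fun n hn ω => abs_sampleDistVar_sub_le F hn _) (hne.mono fun n hn => (hK n hn).2)
  -- Triangle inequality through 𝒱ₙ²: the extra bound has mean at most 48 T₁/n, so the linear term,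
  -- and with it the limit, is unchanged.
  have hhat := tendstoInDistribution_of_distVar_remainder hlaw hindep h4
    (T := fun n ω => hatDistVar fun i : Fin n => X i ω)
    (B := fun n ω => 48 / (n : ℝ) ^ 3 * (∑ i : Fin n, ∑ j : Fin n, ‖X i ω - X j ω‖ ^ 2) +
      remainderBound F fun i : Fin n => X i ω) (K := 48 * popT1 F + K)
    (fun n => (measurable_hatDistVar n).comp_aemeasurable (hX n))
    (fun n => ((hS n).1.const_mul _).add (hB0 n)) ?_ ?_
  · exact ⟨hγ, hV.1, hhat.1, fun h => ⟨hV.2 h, hhat.2 h⟩⟩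
  · filter_upwards [eventually_ge_atTop 3] with n hn ω
    have h1 := abs_hatDistVar_sub_le (fun i : Fin n => X i ω) hn
    have h2 := abs_sampleDistVar_sub_le F (by omega) (fun i : Fin n => X i ω)
    refine le_trans (le_of_eq ?_) ((abs_add_le _ _).trans (add_le_add h1 h2))
    congr 1
    ring
  · filter_upwards [hne] with n hn
    have hn' : (0 : ℝ) < n := by exact_mod_cast Nat.pos_of_ne_zero hn
    rw [integral_add ((hS n).1.const_mul _) (hB0 n), integral_const_mul]
    have h1 := mul_le_mul_of_nonneg_left (hS n).2 (show 0 ≤ 48 / (n : ℝ) ^ 3 by positivity)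
    have h2 : 48 / (n : ℝ) ^ 3 * (popT1 F * (n : ℝ) ^ 2) = 48 * popT1 F / n := by field_simp
    rw [add_div]
    linarith [(hK n hn).2]
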